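/- **Setting.** All notions below are formulated in the language of second order arithmetic. $\mathsf{RCA}_0$ consists of the basic axioms for $0,1,+,\cdot,<$, induction for $\Sigma^0_1$ formulas and comprehension for $\Delta^0_1$ formulas. *Size-change graphs.* Every function identifier $f$ has an arity $n$ and parameters $\mathrm{Var}(f)=\{x_0,\dots,x_{n-1}\}$. A size-change graph $G:f\to g$ is a finite set of arcs $x\xrightarrow{r}y$ with $x\in \mathrm{Var}(f)$, $y\in \mathrm{Var}(g)$ and $r\in\{\downarrow,\Downarrow\}$ (strict, non-strict), with at most one arc from $x$ to $y$ for all $x,y$. For $G_0:f\to g$ and $G_1:g\to h$ the composition $G_0;G_1:f\to h$ has an arc from $x$ to $z$ iff there are arcs $x\to y$ in $G_0$ and $y\to z$ in $G_1$ for some $y$; the arc is non-strict if all arcs $x\to y$ in $G_0$ and $y\to z$ in $G_1$, for all such $y$, are non-strict, and strict otherwise. $G$ is idempotent if $G;G=G$. For a finite set $\mathcal G$ of size-change graphs, $\mathrm{cl}(\mathcal G)$ is the smallest set that contains $\mathcal G$ and is closed under composition (of composable graphs). A multipath is an infinite sequence $G_0,G_1,\dots$ of size-change graphs such that the target of $G_i$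 is the source of $G_{i+1}$ for all $i$. It has infinite descent if, for some $t$, there is an infinite connected path of arcs starting in $G_t$ (one arc in each $G_{t+i}$, $i\ge 0$) with infinitely many strict arcs. $\mathcal G$ is size-change terminating (SCT) if every multipath of graphs in $\mathcal G$ has infinite descent. *Programs.* A program is a finite nonempty list of definitions $f(x_0,\dots,x_{n-1})=e^f$ of distinct functions, with a distinguished initial function, where the body $e^f$ is an expression in the parameters of $f$ given by the grammar $$a ::= x \mid x+1 \mid x-1 \mid o(a,\dots,a) \mid g(a,\dots,a),$$ $$b ::= x=0 \mid x=1 \mid x<y \mid x\le y \mid b\wedge b \mid b\vee b \mid \neg b,\qquad e ::= a \mid \textbf{if } b \textbf{ then } e \textbf{ else } e,$$ with $o$ a primitive operator (of any arity, including $0$) and $g$ a function of the program, applied to as many arguments as its arity. A call $\tau:f\to g$ is an occurrence of a subexpression $g(a,\dots,a)$ in $e^f$. A description of a program $P$ is a finite set $\mathcal G=\{G_\tau : \tau \text{ a call of } P\}$, where to every call $\tau:f\to g$ of $P$ there is assigned exactly one size-change graph $G_\tau:f\to g$ (different calls may have the same graph). **Proposition ($\mathsf{RCA}_0$).** The following two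 statements are provably equivalent in $\mathsf{RCA}_0$: 1. (SCT criterion) For every program $P$ and every description $\mathcal G$ of $P$: $\mathcal G$ is SCT if and only if every idempotent $G\in \mathrm{cl}(\mathcal G)$ has an arc $x\xrightarrow{\downarrow}x$ for some parameter $x$. 2. (SCT criterion for graphs) For every finite set $\mathcal G$ of size-change graphs: $\mathcal G$ is SCT if and only if every idempotent $G\in \mathrm{cl}(\mathcal G)$ has an arc $x\xrightarrow{\downarrow}x$ for some parameter $x$. -/

import Mathlib

/-! ### Second order arithmetic -/

namespace SOA

/-- Number terms of the language `L₂` of second order arithmetic; variables are `v₀, v₁, …`. -/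
inductive Term where
  | var : ℕ → Term
  | zero : Term
  | one : Term
  | add : Term → Term → Term
  | mul : Term → Term → Term

/-- `t.Uses x`: the variable `vₓ` occurs in `t`. -/
def Term.Uses (x : ℕ) : Term → Prop
  | .var i => i = x
  | .zero => False
  | .one => False
  | .add s t => s.Uses x ∨ t.Uses x
  | .mul s t => s.Uses x ∨ t.Uses x

/-- Formulas of `L₂`, with number variables `v₀, v₁, …` and set variables `V₀, V₁, …`. -/
inductive Formula where
  | eq : Term → Term → Formula
  | lt : Term → Term → Formula
  | mem : Term → ℕ → Formula
  | neg : Formula → Formula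
  | and : Formula → Formula → Formula
  | or : Formula → Formula → Formula
  | imp : Formula → Formula → Formula
  | iff : Formula → Formula → Formula
  | all : ℕ → Formula → Formula
  | ex : ℕ → Formula → Formula
  | allSet : ℕ → Formula → Formula
  | exSet : ℕ → Formula → Formula

/-- Bounded quantifier formulas (`Σ⁰₀`), with arbitrary number and set parameters. -/
inductive Formula.IsDelta0 : Formula → Prop
  | eq (s t : Term) : IsDelta0 (.eq s t)
  | lt (s t : Term) : IsDelta0 (.lt s t)
  | mem (t : Term) (X : ℕ) : IsDelta0 (.mem t X)
  | neg {φ : Formula} : IsDelta0 φ → IsDelta0 (.neg φ)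
  | and {φ ψ : Formula} : IsDelta0 φ → IsDelta0 ψ → IsDelta0 (.and φ ψ)
  | or {φ ψ : Formula} : IsDelta0 φ → IsDelta0 ψ → IsDelta0 (.or φ ψ)
  | imp {φ ψ : Formula} : IsDelta0 φ → IsDelta0 ψ → IsDelta0 (.imp φ ψ)
  | iff {φ ψ : Formula} : IsDelta0 φ → IsDelta0 ψ → IsDelta0 (.iff φ ψ)
  | allLt {x : ℕ} {t : Term} {φ : Formula} : ¬ t.Uses x → IsDelta0 φ →
      IsDelta0 (.all x (.imp (.lt (.var x) t) φ))
  | exLt {x : ℕ} {t : Term} {φ : Formula} : ¬ t.Uses x → IsDelta0 φ →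
      IsDelta0 (.ex x (.and (.lt (.var x) t) φ))

/-- `Σ⁰₁` formulas: `∃ x θ` with `θ` a bounded quantifier formula. -/
def Formula.IsSigma1 (φ : Formula) : Prop := ∃ x θ, θ.IsDelta0 ∧ φ = .ex x θ

/-- `Π⁰₁` formulas: `∀ x θ` with `θ` a bounded quantifier formula. -/
def Formula.IsPi1 (φ : Formula) : Prop := ∃ x θ, θ.IsDelta0 ∧ φ = .all x θ

/-- `L₂`-structures in the Henkin sense: arbitrary first order part, and set variables ranging over
an arbitrary nonempty family of subsets of it. -/
structure Model where
  Num : Type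
  zero : Num
  one : Num
  add : Num → Num → Num
  mul : Num → Num → Num
  lt : Num → Num → Prop
  sets : Set (Set Num)
  sets_nonempty : sets.Nonempty

namespace Model

/-- The value of a term under an assignment `v` of the number variables. -/
def eval (M : Model) (v : ℕ → M.Num) : Term → M.Num
  | .var i => v i
  | .zero => M.zero
  | .one => M.one
  | .add s t => M.add (M.eval v s) (M.eval v t)
  | .mul s t => M.mul (M.eval v s) (M.eval v t)

/-- Satisfaction of a formula under assignments `v`, `V` of the number and set variables. -/
def Sat (M : Model) (v : ℕ → M.Num) (V : ℕ → M.sets) : Formula → Prop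
  | .eq s t => M.eval v s = M.eval v t
  | .lt s t => M.lt (M.eval v s) (M.eval v t)
  | .mem t X => M.eval v t ∈ (V X : Set M.Num)
  | .neg φ => ¬ M.Sat v V φ
  | .and φ ψ => M.Sat v V φ ∧ M.Sat v V ψ
  | .or φ ψ => M.Sat v V φ ∨ M.Sat v V ψ
  | .imp φ ψ => M.Sat v V φ → M.Sat v V ψ
  | .iff φ ψ => (M.Sat v V φ ↔ M.Sat v V ψ)
  | .all x φ => ∀ a : M.Num, M.Sat (Function.update v x a) V φ
  | .ex x φ => ∃ a : M.Num, M.Sat (Function.update v x a) V φ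
  | .allSet X φ => ∀ A : M.sets, M.Sat v (Function.update V X A) φ
  | .exSet X φ => ∃ A : M.sets, M.Sat v (Function.update V X A) φ

/-- `M` is a model of `RCA₀`: the basic axioms, induction for all `Σ⁰₁` formulas and comprehension
for all `Δ⁰₁` formulas, both with arbitrary number and set parameters. -/
structure IsModelRCA0 (M : Model) : Prop where
  succ_ne_zero : ∀ m, M.add m M.one ≠ M.zero
  succ_inj : ∀ m n, M.add m M.one = M.add n M.one → m = n
  add_zero : ∀ m, M.add m M.zero = m
  add_succ : ∀ m n, M.add m (M.add n M.one) = M.add (M.add m n) M.one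
  mul_zero : ∀ m, M.mul m M.zero = M.zero
  mul_succ : ∀ m n, M.mul m (M.add n M.one) = M.add (M.mul m n) m
  not_lt_zero : ∀ m, ¬ M.lt m M.zero
  lt_succ : ∀ m n, M.lt m (M.add n M.one) ↔ M.lt m n ∨ m = n
  sigma1_induction : ∀ (φ : Formula) (x : ℕ) (v : ℕ → M.Num) (V : ℕ → M.sets), φ.IsSigma1 →
    M.Sat (Function.update v x M.zero) V φ →
    (∀ a, M.Sat (Function.update v x a) V φ →
      M.Sat (Function.update v x (M.add a M.one)) V φ) →
    ∀ a, M.Sat (Function.update v x a) V φ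
  delta1_comprehension : ∀ (φ ψ : Formula) (x : ℕ) (v : ℕ → M.Num) (V : ℕ → M.sets),
    φ.IsSigma1 → ψ.IsPi1 →
    (∀ a, M.Sat (Function.update v x a) V φ ↔ M.Sat (Function.update v x a) V ψ) →
    ∃ A ∈ M.sets, ∀ a, a ∈ A ↔ M.Sat (Function.update v x a) V φ

end Model

/-- `RCA₀ ⊢ φ`, rendered as truth of (the universal closure of) `φ` in all models of `RCA₀`; by the
completeness theorem for the two-sorted first order logic of `L₂` this is provability. -/
def RCA0Proves (φ : Formula) : Prop :=
  ∀ M : Model, M.IsModelRCA0 → ∀ (v : ℕ → M.Num) (V : ℕ → M.sets), M.Sat v V φ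

/-! ### Writing down formulas

A `Fml` is a formula waiting for a number `d` such that the variables `v_d, v_{d+1}, …` and
`V_d, V_{d+1}, …` are still unused. A quantifier takes `v_d` (or `V_d`) as its bound variable and
passes `d + 1` on, so that no variable is ever captured. -/

abbrev Fml := ℕ → Formula

/-- A set variable, given by its index. -/
abbrev SetVar := ℕ

def eq (s t : Term) : Fml := fun _ => .eq s t
def lt (s t : Term) : Fml := fun _ => .lt s t
def mem (t : Term) (X : SetVar) : Fml := fun _ => .mem t X
def neg (φ : Fml) : Fml := fun d => .neg (φ d)
def and (φ ψ : Fml) : Fml := fun d => .and (φ d) (ψ d)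
def or (φ ψ : Fml) : Fml := fun d => .or (φ d) (ψ d)
def imp (φ ψ : Fml) : Fml := fun d => .imp (φ d) (ψ d)
def iff (φ ψ : Fml) : Fml := fun d => .iff (φ d) (ψ d)
def all (φ : Term → Fml) : Fml := fun d => .all d (φ (.var d) (d + 1))
def ex (φ : Term → Fml) : Fml := fun d => .ex d (φ (.var d) (d + 1))
def allSet (φ : SetVar → Fml) : Fml := fun d => .allSet d (φ d (d + 1))
def exSet (φ : SetVar → Fml) : Fml := fun d => .exSet d (φ d (d + 1))

/-- The `L₂`-sentence obtained from a closed `Fml`. -/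
def sentence (φ : Fml) : Formula := φ 0

infix:50 "≐" => SOA.eq
infix:50 "≺" => SOA.lt
infix:50 "∊" => SOA.mem
prefix:max "∼" => SOA.neg
infixr:35 "⋏" => SOA.and
infixr:30 "⋎" => SOA.or
infixr:25 "➝" => SOA.imp
infix:20 "⟺" => SOA.iff

/-- There is exactly one number with property `φ`. -/
def exUnique (φ : Term → Fml) : Fml := ex fun x => φ x ⋏ all fun y => φ y ➝ y ≐ x

/-- Numerals. -/
def num : ℕ → Term
  | 0 => .zero
  | k + 1 => .add (num k) .one

def succ (t : Term) : Term := .add t .one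

/-- The pairing function `(i, j) = (i + j)² + i`. -/
def pr (i j : Term) : Term := .add (.mul (.add i j) (.add i j)) i

/-- `X` is finite, i.e. bounded. -/
def isFinite (X : SetVar) : Fml := ex fun b => all fun x => x ∊ X ➝ x ≺ b

/-- `i` is an element of the finite set with code `c = (k, (m, n))`, that is, `i < k` and
`m (i + 1) + 1` divides `n`. -/
def codeMem (i c : Term) : Fml :=
  ex fun k => ex fun m => ex fun n => c ≐ pr k (pr m n) ⋏ i ≺ k ⋏
    ex fun q => n ≐ .mul q (succ (.mul m (succ i)))

/-- `c` is *the* code of a finite set of numbers: the least number with these elements. -/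
def isCode (c : Term) : Fml :=
  all fun c' => c' ≺ c ➝ ∼(all fun i => codeMem i c' ⟺ codeMem i c)

/-- `X` is a function from the numbers to the numbers: for each `n` it contains exactly one pair
`(n, y)`. -/
def isFunction (X : SetVar) : Fml := all fun n => exUnique fun y => pr n y ∊ X

end SOA

/-! ### Size-change graphs, inside second order arithmetic -/

namespace SCT

open SOA

/-- `f` is a function identifier of arity `n`, i.e. `f = (a, n)` for some name `a`. Its parameters
are `x₀, …, x_{n-1}`, and `x_i` is represented by `i`. -/
def isFun (f n : Term) : Fml := ex fun a => f ≐ pr a n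

/-- The kinds of arcs. -/
def strict : Term := num 0
def weak : Term := num 1

/-- The arc of kind `r` from `x_x` to `x_y`. -/
def arcCode (x r y : Term) : Term := pr x (pr r y)

/-- `G` is a size-change graph `f → g`: a triple `(f, g, A)` with `A` the code of a finite set of
arcs between the parameters of `f` and of `g`, with at most one arc between any two. -/
def isGraph (G f g : Term) : Fml :=
  ex fun A => ex fun n => ex fun m => G ≐ pr f (pr g A) ⋏ isFun f n ⋏ isFun g m ⋏ isCode A ⋏
    (all fun e => codeMem e A ➝ ex fun x => ex fun r => ex fun y =>
      e ≐ arcCode x r y ⋏ x ≺ n ⋏ (r ≐ strict ⋎ r ≐ weak) ⋏ y ≺ m) ⋏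
    (all fun x => all fun y => ∼(codeMem (arcCode x strict y) A ⋏ codeMem (arcCode x weak y) A))

/-- `G` has an arc of kind `r` from `x` to `y`. -/
def hasArc (G x r y : Term) : Fml :=
  ex fun f => ex fun g => ex fun A => G ≐ pr f (pr g A) ⋏ codeMem (arcCode x r y) A

/-- `H = G₀ ; G₁` (in particular the target of `G₀` is the source of `G₁`). -/
def isComp (H G₀ G₁ : Term) : Fml :=
  ex fun f => ex fun g => ex fun h => isGraph G₀ f g ⋏ isGraph G₁ g h ⋏ isGraph H f h ⋏
    all fun x => all fun z =>
      (hasArc H x strict z ⟺ (ex fun y => ex fun r =>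
        (hasArc G₀ x strict y ⋏ hasArc G₁ y r z) ⋎ (hasArc G₀ x r y ⋏ hasArc G₁ y strict z))) ⋏
      (hasArc H x weak z ⟺ ((ex fun y => hasArc G₀ x weak y ⋏ hasArc G₁ y weak z) ⋏
        all fun y => all fun r => all fun r' =>
          (hasArc G₀ x r y ⋏ hasArc G₁ y r' z) ➝ (r ≐ weak ⋏ r' ≐ weak)))

def isIdempotent (G : Term) : Fml := isComp G G G

/-- `𝒢` is a finite set of size-change graphs. -/
def isGraphSet (𝒢 : SetVar) : Fml :=
  isFinite 𝒢 ⋏ all fun G => G ∊ 𝒢 ➝ ex fun f => ex fun g => isGraph G f g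

/-- `G ∈ cl(𝒢)`, the smallest set that contains `𝒢` and is closed under composition. -/
def inClosure (G : Term) (𝒢 : SetVar) : Fml :=
  allSet fun X =>
    ((all fun H => H ∊ 𝒢 ➝ H ∊ X) ⋏
      (all fun G₀ => all fun G₁ => all fun H =>
        (G₀ ∊ X ⋏ G₁ ∊ X ⋏ isComp H G₀ G₁) ➝ H ∊ X)) ➝ G ∊ X

/-- `F` is an infinite multipath `G₀, G₁, …`. -/
def isMultipath (F : SetVar) : Fml :=
  isFunction F ⋏ all fun n => all fun G => all fun G' =>
    (pr n G ∊ F ⋏ pr (succ n) G' ∊ F) ➝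
      ex fun f => ex fun g => ex fun h => isGraph G f g ⋏ isGraph G' g h

/-- For some `t`, the multipath `F` has a thread `T 0 → T 1 → T 2 → …` starting at `G_t`, with an
arc of `G_{t+i}` from `T i` to `T (i+1)` for all `i`, infinitely many of them strict. -/
def hasInfiniteDescent (F : SetVar) : Fml :=
  ex fun t => exSet fun T => isFunction T ⋏
    (all fun i => all fun G => all fun x => all fun y =>
      (pr (.add t i) G ∊ F ⋏ pr i x ∊ T ⋏ pr (succ i) y ∊ T) ➝ ex fun r => hasArc G x r y) ⋏
    (all fun b => ex fun i => b ≺ i ⋏ ex fun G => ex fun x => ex fun y =>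
      pr (.add t i) G ∊ F ⋏ pr i x ∊ T ⋏ pr (succ i) y ∊ T ⋏ hasArc G x strict y)

/-- `𝒢` is size-change terminating. -/
def isSCT (𝒢 : SetVar) : Fml :=
  allSet fun F => (isMultipath F ⋏ all fun n => all fun G => pr n G ∊ F ➝ G ∊ 𝒢) ➝
    hasInfiniteDescent F

/-- `𝒢` is SCT iff every idempotent `G ∈ cl(𝒢)` has a strict arc from some `x` to `x`. -/
def criterionFor (𝒢 : SetVar) : Fml :=
  isSCT 𝒢 ⟺ all fun G => (inClosure G 𝒢 ⋏ isIdempotent G) ➝ ex fun x => hasArc G x strict x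

/-! ### Programs

A program is a finite forest of syntax trees, one for the body of each function, given by three
finite sets of numbers and its initial function:
* `L` contains `(p, (f, l))` iff `p` is a node, with label `l`, of the body of `f`;
* `C` contains `(p, (j, c))` iff the node `c` is the `j`-th child of the node `p`;
* `R` contains `(f, p)` iff `f` is a function of the program and `p` is the root of its body.

The labels are
`(0, i)`: `x_i`; `(1, i)`: `x_i + 1`; `(2, i)`: `x_i - 1`;
`(3, (o, k))`: the primitive operator `o`, applied to `k` arguments;
`(4, g)`: a call of the function `g`;
`(5, i)`: `x_i = 0`; `(6, i)`: `x_i = 1`; `(7, (i, j))`: `x_i < x_j`; `(8, (i, j))`: `x_i ≤ x_j`;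
`(9, 0)`: `∧`; `(10, 0)`: `∨`; `(11, 0)`: `¬`; `(12, 0)`: `if … then … else …`. -/

/-- `p` is a node of the body of `f` with label `l`. -/
def isNode (L : SetVar) (p f l : Term) : Fml := pr p (pr f l) ∊ L

/-- `c` is the `j`-th child of `p`. -/
def isChild (C : SetVar) (p j c : Term) : Fml := pr p (pr j c) ∊ C

/-- `p` is the root of the body of `f`. -/
def isRoot (R : SetVar) (f p : Term) : Fml := pr f p ∊ R

/-- `f` is a function of the program. -/
def isFunctionOf (R : SetVar) (f : Term) : Fml := ex fun p => isRoot R f p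

/-- The node `p` has a label of the form `(k, a)`. -/
def hasTag (L : SetVar) (p : Term) (k : ℕ) : Fml :=
  ex fun f => ex fun a => isNode L p f (pr (num k) a)

/-- `p` is an arithmetic expression. -/
def isArith (L : SetVar) (p : Term) : Fml :=
  hasTag L p 0 ⋎ hasTag L p 1 ⋎ hasTag L p 2 ⋎ hasTag L p 3 ⋎ hasTag L p 4

/-- `p` is a boolean expression. -/
def isBool (L : SetVar) (p : Term) : Fml :=
  hasTag L p 5 ⋎ hasTag L p 6 ⋎ hasTag L p 7 ⋎ hasTag L p 8 ⋎ hasTag L p 9 ⋎ hasTag L p 10 ⋎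
    hasTag L p 11

/-- `p` is an expression. -/
def isExpr (L : SetVar) (p : Term) : Fml := isArith L p ⋎ hasTag L p 12

/-- `p` has exactly the children number `0, …, k - 1`, and `Q j c` holds for the `j`-th child `c`. -/
def hasChildren (C : SetVar) (p k : Term) (Q : Term → Term → Fml) : Fml :=
  (all fun j => all fun c => isChild C p j c ➝ (j ≺ k ⋏ Q j c)) ⋏
    (all fun j => j ≺ k ➝ exUnique fun c => isChild C p j c)

/-- `p` is a leaf. -/
def isLeaf (C : SetVar) (p : Term) : Fml := all fun j => all fun c => ∼(isChild C p j c)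

/-- The node `p` with label `l` in the body of `f` obeys the grammar. -/
def obeysGrammar (L C R : SetVar) (p f l : Term) : Fml :=
  ex fun n => isFun f n ⋏
    ((ex fun i => i ≺ n ⋏ (l ≐ pr (num 0) i ⋎ l ≐ pr (num 1) i ⋎ l ≐ pr (num 2) i) ⋏
        isLeaf C p) ⋎
     (ex fun o => ex fun k => l ≐ pr (num 3) (pr o k) ⋏
        hasChildren C p k fun _ c => isArith L c) ⋎
     (ex fun g => ex fun m => l ≐ pr (num 4) g ⋏ isFunctionOf R g ⋏ isFun g m ⋏
        hasChildren C p m fun _ c => isArith L c) ⋎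
     (ex fun i => i ≺ n ⋏ (l ≐ pr (num 5) i ⋎ l ≐ pr (num 6) i) ⋏ isLeaf C p) ⋎
     (ex fun i => ex fun j => i ≺ n ⋏ j ≺ n ⋏
        (l ≐ pr (num 7) (pr i j) ⋎ l ≐ pr (num 8) (pr i j)) ⋏ isLeaf C p) ⋎
     ((l ≐ pr (num 9) (num 0) ⋎ l ≐ pr (num 10) (num 0)) ⋏
        hasChildren C p (num 2) fun _ c => isBool L c) ⋎
     (l ≐ pr (num 11) (num 0) ⋏ hasChildren C p (num 1) fun _ c => isBool L c) ⋎
     (l ≐ pr (num 12) (num 0) ⋏ hasChildren C p (num 3) fun j c =>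
        (j ≐ num 0 ⋏ isBool L c) ⋎ (∼(j ≐ num 0) ⋏ isExpr L c)))

/-- `(L, C, R, f₀)` is a program with initial function `f₀`. -/
def isProgram (L C R : SetVar) (f₀ : Term) : Fml :=
  isFinite L ⋏ isFinite C ⋏ isFinite R ⋏
  -- a node lies in one body only and has one label, and it obeys the grammar
  (all fun p => all fun f => all fun l => isNode L p f l ➝
    ((all fun f' => all fun l' => isNode L p f' l' ➝ (f' ≐ f ⋏ l' ≐ l)) ⋏
      obeysGrammar L C R p f l)) ⋏
  -- a node is a root or a child; a child is numbered after its parent, has no second parent and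
  -- lies in the same body
  (all fun p => all fun f => all fun l => isNode L p f l ➝
    (isRoot R f p ⋎ ex fun q => ex fun j => isChild C q j p)) ⋏
  (all fun p => all fun j => all fun c => isChild C p j c ➝
    (p ≺ c ⋏ (ex fun f => ex fun l => ex fun l' => isNode L p f l ⋏ isNode L c f l') ⋏
      all fun q => all fun i => isChild C q i c ➝ (q ≐ p ⋏ i ≐ j))) ⋏
  -- each function has an arity and one body, which is an expression and not part of a larger one
  (all fun f => all fun p => isRoot R f p ➝
    ((ex fun n => isFun f n) ⋏ (all fun p' => isRoot R f p' ➝ p' ≐ p) ⋏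
      (ex fun l => isNode L p f l) ⋏ isExpr L p ⋏
      all fun q => all fun j => ∼(isChild C q j p))) ⋏
  isFunctionOf R f₀

/-- `τ` is (a node that is) a call `τ : f → g`. -/
def isCall (L : SetVar) (τ f g : Term) : Fml := isNode L τ f (pr (num 4) g)

/-- `𝒢` is a description of the program with node labels `L`: there is an assignment `D` of exactly
one size-change graph `G_τ : f → g` to every call `τ : f → g`, and `𝒢` is the set of all `G_τ`. -/
def isDescription (𝒢 L : SetVar) : Fml :=
  isGraphSet 𝒢 ⋏ exSet fun D =>
    (all fun τ => all fun f => all fun g => isCall L τ f g ➝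
      ((exUnique fun G => pr τ G ∊ D) ⋏
        all fun G => pr τ G ∊ D ➝ (G ∊ 𝒢 ⋏ isGraph G f g))) ⋏
    (all fun G => G ∊ 𝒢 ➝ ex fun τ => ex fun f => ex fun g => isCall L τ f g ⋏ pr τ G ∊ D)

/-- The SCT criterion: every description of a program satisfies the criterion. -/
def sctCriterion : Fml :=
  allSet fun L => allSet fun C => allSet fun R => all fun f₀ => allSet fun 𝒢 =>
    (isProgram L C R f₀ ⋏ isDescription 𝒢 L) ➝ criterionFor 𝒢

/-- The SCT criterion for graphs: every finite set of size-change graphs satisfies the criterion. -/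
def sctCriterionForGraphs : Fml :=
  allSet fun 𝒢 => isGraphSet 𝒢 ➝ criterionFor 𝒢

end SCT

/-! The criterion for 𝒢 depends on 𝒢 alone, so the equivalence reduces to comparing two classes of
sets. A description of a program is by definition a finite set of size-change graphs, which gives
one direction. The other needs the converse, `exists_program`: every finite set of size-change
graphs is a description of some program. The meaning of SCT, of idempotence and of the closure plays
no role.

Let `b > 0` bound all members of 𝒢. Every function identifier `f < b` receives the body `o(e₀, …,
e_{b-1})` with a `b`-ary operator `o`. If `j` is the code of a graph `f → g` in 𝒢, then `e_j` is a
call of `g` whose arguments are nullary operators; otherwise `e_j` is itself a nullary operator.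
Since the position of a call is the code of its graph, calls correspond exactly to members of 𝒢, and
sending each call to its graph is the required assignment.

Provability means truth in every model of `RCA₀`, possibly nonstandard, so the program has to be
built inside the model. Indexing by codes avoids any enumeration of 𝒢: nodes, edges, roots and the
assignment are all defined by bounded quantifier formulas with parameters `b` and 𝒢, and exist by
comprehension. Induction serves only to develop arithmetic, above all the injectivity and
monotonicity of pairing (`pr_inj`, `pr_lt_pr_of_le`, `lt_of_pr_lt`). The `sat_` lemmas translate the
formal sentences into statements about the model. -/

namespace SOA.Model

/-! ### Arithmetic in a model of `RCA₀` -/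

open Function

/-- The pairing function of a model. -/
def pr (M : Model) (i j : M.Num) : M.Num := M.add (M.mul (M.add i j) (M.add i j)) i

/-- The value of the numeral `k`. -/
def num (M : Model) : ℕ → M.Num
  | 0 => M.zero
  | k + 1 => M.add (M.num k) M.one

namespace IsModelRCA0

variable {M : Model} (hM : M.IsModelRCA0)
include hM

/-- Induction for predicates defined by a bounded quantifier formula. -/
@[elab_as_elim]
theorem delta0_induction {P : M.Num → Prop} (θ : Formula) (hθ : θ.IsDelta0) (v : ℕ → M.Num)
    (h : ∀ V a c, M.Sat (update (update v 0 a) 9 c) V θ ↔ P a)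
    (zero : P M.zero) (succ : ∀ a, P a → P (M.add a M.one)) (a : M.Num) : P a := by
  obtain ⟨A, hA⟩ := M.sets_nonempty
  -- The induction axiom wants a formula `∃ x θ`, so a vacuous quantifier over `v₉` is put in front.
  have key : ∀ a, M.Sat (update v 0 a) (fun _ => ⟨A, hA⟩) (.ex 9 θ) ↔ P a := fun a =>
    ⟨fun ⟨c, hc⟩ => (h _ a c).1 hc, fun ha => ⟨M.zero, (h _ a _).2 ha⟩⟩
  exact (key a).1 (hM.sigma1_induction (.ex 9 θ) 0 v _ ⟨9, θ, hθ, rfl⟩ ((key _).2 zero)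
    (fun a ha => (key _).2 (succ a ((key a).1 ha))) a)

/-- Comprehension for predicates defined by a bounded quantifier formula. -/
theorem delta0_comprehension {P : M.Num → Prop} (θ : Formula) (hθ : θ.IsDelta0) (v : ℕ → M.Num)
    (V : ℕ → M.sets) (x y : ℕ) (h : ∀ a c, M.Sat (update (update v x a) y c) V θ ↔ P a) :
    ∃ A : M.sets, ∀ a, a ∈ A.1 ↔ P a := by
  have hex : ∀ a, M.Sat (update v x a) V (.ex y θ) ↔ P a := fun a =>
    ⟨fun ⟨c, hc⟩ => (h a c).1 hc, fun ha => ⟨M.zero, (h a _).2 ha⟩⟩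
  have hall : ∀ a, M.Sat (update v x a) V (.all y θ) ↔ P a := fun a =>
    ⟨fun hc => (h a _).1 (hc M.zero), fun ha c => (h a c).2 ha⟩
  -- Quantifying the dummy variable existentially and universally yields equivalent `Σ⁰₁` and `Π⁰₁`
  -- forms of the same bounded formula.
  obtain ⟨A, hA, hA'⟩ := hM.delta1_comprehension (.ex y θ) (.all y θ) x v V
    ⟨y, θ, hθ, rfl⟩ ⟨y, θ, hθ, rfl⟩ (fun a => (hex a).trans (hall a).symm)
  exact ⟨⟨A, hA⟩, fun a => (hA' a).trans (hex a)⟩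

protected theorem add_assoc (m n k : M.Num) : M.add (M.add m n) k = M.add m (M.add n k) := by
  refine hM.delta0_induction (.eq (.add (.add (.var 1) (.var 2)) (.var 0))
    (.add (.var 1) (.add (.var 2) (.var 0)))) (.eq _ _) (fun | 1 => m | _ => n)
    (fun _ _ _ => Iff.rfl) ?_ (fun a ih => ?_) k
  · simp only [hM.add_zero]
  · simp only [hM.add_succ, ih]

protected theorem zero_add (n : M.Num) : M.add M.zero n = n := by
  refine hM.delta0_induction (.eq (.add .zero (.var 0)) (.var 0)) (.eq _ _) (fun _ => n)
    (fun _ _ _ => Iff.rfl) ?_ (fun a ih => ?_) n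
  · exact hM.add_zero _
  · simp only [hM.add_succ, ih]

protected theorem succ_add (m n : M.Num) : M.add (M.add m M.one) n = M.add (M.add m n) M.one := by
  refine hM.delta0_induction (.eq (.add (.add (.var 1) .one) (.var 0))
    (.add (.add (.var 1) (.var 0)) .one)) (.eq _ _) (fun _ => m)
    (fun _ _ _ => Iff.rfl) ?_ (fun a ih => ?_) n
  · simp only [hM.add_zero]
  · simp only [hM.add_succ, ih]

protected theorem add_comm (m n : M.Num) : M.add m n = M.add n m := by
  refine hM.delta0_induction (.eq (.add (.var 1) (.var 0)) (.add (.var 0) (.var 1))) (.eq _ _)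
    (fun _ => m) (fun _ _ _ => Iff.rfl) ?_ (fun a ih => ?_) n
  · rw [hM.add_zero, hM.zero_add]
  · rw [hM.add_succ, hM.succ_add, ih]

protected theorem zero_mul (n : M.Num) : M.mul M.zero n = M.zero := by
  refine hM.delta0_induction (.eq (.mul .zero (.var 0)) .zero) (.eq _ _) (fun _ => n)
    (fun _ _ _ => Iff.rfl) ?_ (fun a ih => ?_) n
  · exact hM.mul_zero _
  · rw [hM.mul_succ, ih, hM.add_zero]

theorem succ_mul (m n : M.Num) : M.mul (M.add m M.one) n = M.add (M.mul m n) n := by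
  refine hM.delta0_induction (.eq (.mul (.add (.var 1) .one) (.var 0))
    (.add (.mul (.var 1) (.var 0)) (.var 0))) (.eq _ _) (fun _ => m)
    (fun _ _ _ => Iff.rfl) ?_ (fun a ih => ?_) n
  · simp only [hM.mul_zero, hM.add_zero]
  · rw [hM.mul_succ, ih, hM.mul_succ, hM.add_succ, hM.add_succ, hM.add_assoc _ a m,
      hM.add_comm a m, ← hM.add_assoc _ m a]

protected theorem mul_comm (m n : M.Num) : M.mul m n = M.mul n m := by
  refine hM.delta0_induction (.eq (.mul (.var 1) (.var 0)) (.mul (.var 0) (.var 1))) (.eq _ _)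
    (fun _ => m) (fun _ _ _ => Iff.rfl) ?_ (fun a ih => ?_) n
  · rw [hM.mul_zero, hM.zero_mul]
  · rw [hM.mul_succ, hM.succ_mul, ih]

protected theorem mul_add (m n k : M.Num) : M.mul m (M.add n k) = M.add (M.mul m n) (M.mul m k) := by
  refine hM.delta0_induction (.eq (.mul (.var 1) (.add (.var 2) (.var 0)))
    (.add (.mul (.var 1) (.var 2)) (.mul (.var 1) (.var 0)))) (.eq _ _)
    (fun | 1 => m | _ => n) (fun _ _ _ => Iff.rfl) ?_ (fun a ih => ?_) k
  · simp only [hM.mul_zero, hM.add_zero]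
  · rw [hM.add_succ, hM.mul_succ, ih, hM.mul_succ, hM.add_assoc]

protected theorem mul_assoc (m n k : M.Num) : M.mul (M.mul m n) k = M.mul m (M.mul n k) := by
  refine hM.delta0_induction (.eq (.mul (.mul (.var 1) (.var 2)) (.var 0))
    (.mul (.var 1) (.mul (.var 2) (.var 0)))) (.eq _ _)
    (fun | 1 => m | _ => n) (fun _ _ _ => Iff.rfl) ?_ (fun a ih => ?_) k
  · simp only [hM.mul_zero]
  · rw [hM.mul_succ, ih, hM.mul_succ, hM.mul_add]

protected theorem mul_one (m : M.Num) : M.mul m M.one = m := by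
  rw [← hM.zero_add M.one, hM.mul_succ, hM.mul_zero, hM.zero_add]

theorem lt_succ_self (m : M.Num) : M.lt m (M.add m M.one) := (hM.lt_succ m m).2 (.inr rfl)

protected theorem lt_trans {m n k : M.Num} : M.lt m n → M.lt n k → M.lt m k := by
  refine hM.delta0_induction (P := fun k => M.lt m n → M.lt n k → M.lt m k)
    (.imp (.lt (.var 1) (.var 2)) (.imp (.lt (.var 2) (.var 0)) (.lt (.var 1) (.var 0))))
    (.imp (.lt _ _) (.imp (.lt _ _) (.lt _ _)))
    (fun | 1 => m | _ => n) (fun _ _ _ => Iff.rfl) ?_ (fun a ih => ?_) k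
  · exact fun _ h => (hM.not_lt_zero _ h).elim
  · intro h h'
    rcases (hM.lt_succ _ _).1 h' with h' | rfl
    · exact (hM.lt_succ _ _).2 (.inl (ih h h'))
    · exact (hM.lt_succ _ _).2 (.inl h)

protected theorem zero_le (n : M.Num) : M.lt M.zero n ∨ M.zero = n := by
  refine hM.delta0_induction (P := fun n => M.lt M.zero n ∨ M.zero = n)
    (.or (.lt .zero (.var 0)) (.eq .zero (.var 0))) (.or (.lt _ _) (.eq _ _))
    (fun _ => n) (fun _ _ _ => Iff.rfl) (.inr rfl) (fun a ih => ?_) n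
  exact .inl ((hM.lt_succ _ _).2 ih)

theorem succ_lt_succ {m n : M.Num} : M.lt m n → M.lt (M.add m M.one) (M.add n M.one) := by
  refine hM.delta0_induction (P := fun n => M.lt m n → M.lt (M.add m M.one) (M.add n M.one))
    (.imp (.lt (.var 1) (.var 0)) (.lt (.add (.var 1) .one) (.add (.var 0) .one)))
    (.imp (.lt _ _) (.lt _ _)) (fun _ => m) (fun _ _ _ => Iff.rfl) ?_ (fun a ih => ?_) n
  · exact fun h => (hM.not_lt_zero _ h).elim
  · intro h
    rcases (hM.lt_succ _ _).1 h with h | rfl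
    · exact (hM.lt_succ _ _).2 (.inl (ih h))
    · exact hM.lt_succ_self _

protected theorem lt_trichotomy (m n : M.Num) : M.lt m n ∨ m = n ∨ M.lt n m := by
  refine hM.delta0_induction (P := fun n => M.lt m n ∨ m = n ∨ M.lt n m)
    (.or (.lt (.var 1) (.var 0)) (.or (.eq (.var 1) (.var 0)) (.lt (.var 0) (.var 1))))
    (.or (.lt _ _) (.or (.eq _ _) (.lt _ _)))
    (fun _ => m) (fun _ _ _ => Iff.rfl) ?_ (fun a ih => ?_) n
  · rcases hM.zero_le m with h | h
    · exact .inr (.inr h)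
    · exact .inr (.inl h.symm)
  · rcases ih with h | rfl | h
    · exact .inl ((hM.lt_succ _ _).2 (.inl h))
    · exact .inl (hM.lt_succ_self _)
    · rcases (hM.lt_succ _ _).1 (hM.succ_lt_succ h) with h | h
      · exact .inr (.inr h)
      · exact .inr (.inl h.symm)

protected theorem lt_irrefl (n : M.Num) : ¬ M.lt n n := by
  refine hM.delta0_induction (P := fun n => ¬ M.lt n n)
    (.neg (.lt (.var 0) (.var 0))) (.neg (.lt _ _))
    (fun _ => n) (fun _ _ _ => Iff.rfl) (hM.not_lt_zero _) (fun a ih h => ih ?_) n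
  rcases (hM.lt_succ _ _).1 h with h | h
  · exact hM.lt_trans (hM.lt_succ_self a) h
  · have := hM.lt_succ_self a
    rwa [h] at this

protected theorem add_lt_add_right {m n : M.Num} (h : M.lt m n) (k : M.Num) :
    M.lt (M.add m k) (M.add n k) := by
  refine hM.delta0_induction (.lt (.add (.var 1) (.var 0)) (.add (.var 2) (.var 0))) (.lt _ _)
    (fun | 1 => m | _ => n) (fun _ _ _ => Iff.rfl) ?_ (fun a ih => ?_) k
  · simpa only [hM.add_zero] using h
  · simpa only [hM.add_succ] using hM.succ_lt_succ ih

/-- Writing the positive factor as a successor lets the induction start at the factor one without a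
positivity hypothesis. -/
theorem mul_lt_mul_succ {m n : M.Num} (h : M.lt m n) (k : M.Num) :
    M.lt (M.mul m (M.add k M.one)) (M.mul n (M.add k M.one)) := by
  refine hM.delta0_induction
    (.lt (.mul (.var 1) (.add (.var 0) .one)) (.mul (.var 2) (.add (.var 0) .one))) (.lt _ _)
    (fun | 1 => m | _ => n) (fun _ _ _ => Iff.rfl) ?_ (fun a ih => ?_) k
  · simpa only [hM.zero_add, hM.mul_one] using h
  · rw [hM.mul_succ m, hM.mul_succ n]
    refine hM.lt_trans (hM.add_lt_add_right ih m) ?_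
    rw [hM.add_comm _ m, hM.add_comm _ n]
    exact hM.add_lt_add_right h _

theorem eq_zero_or_succ (n : M.Num) : n = M.zero ∨ ∃ k, n = M.add k M.one := by
  rcases hM.zero_le n with h | h
  · refine .inr ?_
    revert h
    -- The predecessor is smaller than the number, so its existence can be expressed with a bounded
    -- quantifier.
    refine hM.delta0_induction (P := fun n => M.lt M.zero n → ∃ k, n = M.add k M.one)
      (.imp (.lt .zero (.var 0)) (.ex 1 (.and (.lt (.var 1) (.var 0))
        (.eq (.var 0) (.add (.var 1) .one)))))
      (.imp (.lt _ _) (.exLt (by simp [Term.Uses]) (.eq _ _)))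
      (fun _ => n) (fun _ a _ => ?_) ?_ (fun a _ _ => ⟨a, rfl⟩) n
    · refine imp_congr_right fun _ => ⟨fun ⟨k, _, hk⟩ => ⟨k, hk⟩, fun ⟨k, hk⟩ => ⟨k, ?_, hk⟩⟩
      change M.lt k a
      rw [hk]
      exact hM.lt_succ_self k
    · exact fun h => (hM.not_lt_zero _ h).elim
  · exact .inl h.symm

/-- The numbers of a model of `RCA₀` form a commutative semiring. -/
@[reducible] def commSemiring : CommSemiring M.Num :=
  letI : Zero M.Num := ⟨M.zero⟩
  letI : Add M.Num := ⟨M.add⟩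
  { add := M.add
    zero := M.zero
    one := M.one
    mul := M.mul
    add_assoc := hM.add_assoc
    zero_add := hM.zero_add
    add_zero := hM.add_zero
    add_comm := hM.add_comm
    mul_assoc := hM.mul_assoc
    mul_comm := hM.mul_comm
    one_mul n := (hM.mul_comm _ _).trans (hM.mul_one n)
    mul_one := hM.mul_one
    zero_mul := hM.zero_mul
    mul_zero := hM.mul_zero
    left_distrib := hM.mul_add
    right_distrib m n k := by
      change M.mul (M.add m n) k = M.add (M.mul m k) (M.mul n k)
      rw [hM.mul_comm, hM.mul_add, hM.mul_comm k m, hM.mul_comm k n]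
    nsmul := nsmulRec }

open Classical in
/-- The numbers of a model of `RCA₀` are linearly ordered. -/
@[reducible] noncomputable def linearOrder : LinearOrder M.Num where
  le m n := M.lt m n ∨ m = n
  lt := M.lt
  le_refl _ := .inr rfl
  le_trans := by
    rintro a b c (h | rfl) (h' | rfl)
    · exact .inl (hM.lt_trans h h')
    · exact .inl h
    · exact .inl h'
    · exact .inr rfl
  lt_iff_le_not_ge a b := by
    refine ⟨fun h => ⟨.inl h, ?_⟩, fun ⟨h, h'⟩ => h.resolve_right fun e => h' (.inr e.symm)⟩
    rintro (h' | rfl)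
    · exact hM.lt_irrefl _ (hM.lt_trans h h')
    · exact hM.lt_irrefl _ h
  le_antisymm := by
    rintro a b (h | rfl) (h' | h')
    · exact (hM.lt_irrefl _ (hM.lt_trans h h')).elim
    · exact h'.symm
    · rfl
    · rfl
  le_total a b := by
    rcases hM.lt_trichotomy a b with h | h | h
    · exact .inl (.inl h)
    · exact .inl (.inr h)
    · exact .inr (.inl h)
  toDecidableLE := inferInstance

/-- Makes the general theory of ordered semirings available for the inequalities on pairing. -/
theorem isStrictOrderedRing :
    letI := hM.commSemiring
    letI := hM.linearOrder
    IsStrictOrderedRing M.Num := by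
  let := hM.commSemiring
  let := hM.linearOrder
  have hmul : ∀ a : M.Num, 0 < a → ∀ b c : M.Num, b < c → a * b < a * c := by
    intro a ha b c h
    rcases hM.eq_zero_or_succ a with rfl | ⟨k, rfl⟩
    · exact (hM.lt_irrefl _ ha).elim
    · have := hM.mul_lt_mul_succ h k
      rwa [hM.mul_comm b, hM.mul_comm c] at this
  have hadd : ∀ a b : M.Num, a < b → ∀ c, a + c < b + c := fun a b h c =>
    hM.add_lt_add_right h c
  have hadd' : ∀ a b : M.Num, a ≤ b → ∀ c, a + c ≤ b + c := fun a b h c => by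
    rcases h with h | rfl
    · exact .inl (hadd a b h c)
    · exact .inr rfl
  exact
    { add_le_add_left := hadd'
      le_of_add_le_add_left := fun a b c h => by
        by_contra hcb
        have := hadd c b (lt_of_not_ge hcb) a
        rw [add_comm c, add_comm b] at this
        exact absurd h (not_le_of_gt this)
      zero_le_one := hM.zero_le _
      mul_lt_mul_of_pos_left := hmul
      mul_lt_mul_of_pos_right := fun a ha b c h => by
        have := hmul a ha b c h
        rwa [mul_comm a, mul_comm a] at this
      exists_pair_ne := ⟨0, 1, fun h => hM.succ_ne_zero M.zero
        ((hM.zero_add M.one).trans h.symm)⟩ }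

/-- Discreteness of the order: it turns a strict inequality of sums into the gap between consecutive
squares used for pairing. -/
protected theorem lt_add_one_iff :
    letI := hM.commSemiring
    letI := hM.linearOrder
    ∀ a b : M.Num, a < b ↔ a + 1 ≤ b := by
  let := hM.commSemiring
  let := hM.linearOrder
  intro a b
  refine ⟨fun h => ?_, fun h => lt_of_lt_of_le (show a < a + 1 from hM.lt_succ_self a) h⟩
  by_contra hab
  rcases (hM.lt_succ _ _).1 (lt_of_not_ge hab : b < a + 1) with h' | rfl
  · exact lt_asymm h h'
  · exact lt_irrefl _ h

theorem exists_lt (a b : M.Num) : ∃ c, M.lt a c ∧ M.lt b c := by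
  rcases hM.lt_trichotomy a b with h | rfl | h
  · exact ⟨_, hM.lt_trans h (hM.lt_succ_self b), hM.lt_succ_self b⟩
  · exact ⟨_, hM.lt_succ_self a, hM.lt_succ_self a⟩
  · exact ⟨_, hM.lt_succ_self a, hM.lt_trans h (hM.lt_succ_self a)⟩

/-- With `s = i + j`, the value `s² + i` lies between `s²` and `(s + 1)²`, the latter excluded,
because `i ≤ s`. So the code determines `s`, then `i`, then `j`. -/
theorem pr_inj {i j i' j' : M.Num} : M.pr i j = M.pr i' j' ↔ i = i' ∧ j = j' := by
  let := hM.commSemiring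
  let := hM.linearOrder
  have := hM.isStrictOrderedRing
  have pos : ∀ a : M.Num, 0 ≤ a := hM.zero_le
  have key : ∀ i j i' j' : M.Num, i + j < i' + j' →
      (i + j) * (i + j) + i < (i' + j') * (i' + j') + i' := by
    intro i j i' j' h
    have h1 := (hM.lt_add_one_iff _ _).1 h
    have h2 : (i + j + 1) * (i + j + 1) ≤ (i' + j') * (i' + j') :=
      mul_le_mul h1 h1 (pos _) (pos _)
    have h3 : i < i + j + (i + j) + 1 := by
      refine (hM.lt_add_one_iff _ _).2 (add_le_add_left ?_ 1)
      rw [add_assoc]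
      exact le_add_of_nonneg_right (pos _)
    calc (i + j) * (i + j) + i < (i + j) * (i + j) + (i + j + (i + j) + 1) :=
          add_lt_add_right h3 _
      _ = (i + j + 1) * (i + j + 1) := by ring
      _ ≤ (i' + j') * (i' + j') := h2
      _ ≤ (i' + j') * (i' + j') + i' := le_add_of_nonneg_right (pos _)
  refine ⟨fun h => ?_, fun ⟨h, h'⟩ => by rw [h, h']⟩
  change (i + j) * (i + j) + i = (i' + j') * (i' + j') + i' at h
  rcases lt_trichotomy (i + j) (i' + j') with h' | h' | h'
  · exact absurd h (key _ _ _ _ h').ne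
  · rw [h'] at h
    obtain rfl : i = i' := by
      rcases lt_trichotomy i i' with h1 | h1 | h1
      · exact absurd h (add_lt_add_right h1 _).ne
      · exact h1
      · exact absurd h (add_lt_add_right h1 _).ne'
    refine ⟨rfl, ?_⟩
    rcases lt_trichotomy j j' with h1 | h1 | h1
    · exact absurd h' (add_lt_add_right h1 _).ne
    · exact h1
    · exact absurd h' (add_lt_add_right h1 _).ne'
  · exact absurd h (key _ _ _ _ h').ne'

/-- The weak inequality is monotonicity of the polynomial; equality is excluded by injectivity. -/
theorem pr_lt_pr_of_le :
    letI := hM.linearOrder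
    ∀ {i j i' j' : M.Num}, i ≤ i' → j ≤ j' → (i < i' ∨ j < j') → M.pr i j < M.pr i' j' := by
  let := hM.commSemiring
  let := hM.linearOrder
  have := hM.isStrictOrderedRing
  have pos : ∀ a : M.Num, 0 ≤ a := hM.zero_le
  intro i j i' j' hi hj h
  have h1 : i + j ≤ i' + j' := add_le_add hi hj
  refine lt_of_le_of_ne (add_le_add (mul_le_mul h1 h1 (pos _) (pos _)) hi : _ + i ≤ _ + i') ?_
  intro e
  obtain ⟨rfl, rfl⟩ := hM.pr_inj.1 e
  rcases h with h | h <;> exact lt_irrefl _ h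

theorem pr_lt_pr {i j i' j' : M.Num} (hi : M.lt i i') (hj : M.lt j j') :
    M.lt (M.pr i j) (M.pr i' j') :=
  hM.pr_lt_pr_of_le (.inl hi) (.inl hj) (.inl hi)

theorem pr_lt_pr_left {i i' : M.Num} (hi : M.lt i i') (j : M.Num) :
    M.lt (M.pr i j) (M.pr i' j) :=
  hM.pr_lt_pr_of_le (.inl hi) (.inr rfl) (.inl hi)

theorem pr_lt_pr_right (i : M.Num) {j j' : M.Num} (hj : M.lt j j') :
    M.lt (M.pr i j) (M.pr i j') :=
  hM.pr_lt_pr_of_le (.inr rfl) (.inl hj) (.inr hj)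

/-- Components never exceed their pair, since `j ≤ i + j ≤ (i + j)²`. Hence a bound on codes also
bounds everything decoded from them, which keeps the later definitions within bounded quantifiers.
-/
theorem lt_of_pr_lt {i j b : M.Num} (h : M.lt (M.pr i j) b) : M.lt i b ∧ M.lt j b := by
  let := hM.commSemiring
  let := hM.linearOrder
  have := hM.isStrictOrderedRing
  have pos : ∀ a : M.Num, 0 ≤ a := hM.zero_le
  have le_sq : ∀ a : M.Num, a ≤ a * a := fun a => by
    rcases hM.eq_zero_or_succ a with rfl | ⟨k, rfl⟩
    · exact pos _
    · change k + 1 ≤ (k + 1) * (k + 1)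
      exact le_mul_of_one_le_right (pos _) (le_add_of_nonneg_left (pos _))
  have h1 : i ≤ M.pr i j := le_add_of_nonneg_left (pos ((i + j) * (i + j)))
  have h2 : j ≤ M.pr i j := calc
    j ≤ i + j := le_add_of_nonneg_left (pos _)
    _ ≤ (i + j) * (i + j) := le_sq _
    _ ≤ (i + j) * (i + j) + i := le_add_of_nonneg_right (pos _)
  have h' : M.pr i j < b := h
  exact ⟨h1.trans_lt h', h2.trans_lt h'⟩

/-- Distinguishes the numerical tags of labels, even in a nonstandard model. -/
theorem num_inj {k l : ℕ} : M.num k = M.num l ↔ k = l := by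
  refine ⟨?_, fun h => h ▸ rfl⟩
  induction k generalizing l with
  | zero =>
    cases l with
    | zero => exact fun _ => rfl
    | succ l => exact fun h => (hM.succ_ne_zero _ h.symm).elim
  | succ k ih =>
    cases l with
    | zero => exact fun h => (hM.succ_ne_zero _ h).elim
    | succ l => exact fun h => congrArg _ (ih (hM.succ_inj _ _ h))

end IsModelRCA0

end SOA.Model

/-! ### Evaluation and satisfaction without variable capture -/

namespace SOA

/-- All variables of the term `t` have an index below `t.bd`. -/
def Term.bd : Term → ℕ
  | .var i => i + 1
  | .zero => 0
  | .one => 0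
  | .add s t => max s.bd t.bd
  | .mul s t => max s.bd t.bd

theorem bd_pr (s t : Term) : (SOA.pr s t).bd = max s.bd t.bd := by
  simp only [SOA.pr, Term.bd]; omega

theorem bd_succ (t : Term) : (SOA.succ t).bd = t.bd := by
  simp only [SOA.succ, Term.bd]; omega

theorem bd_num (k : ℕ) : (SOA.num k).bd = 0 := by
  induction k with
  | zero => rfl
  | succ k ih => simp only [SOA.num, Term.bd, ih]; omega

theorem bd_arcCode (x r y : Term) : (SCT.arcCode x r y).bd = max x.bd (max r.bd y.bd) := by
  simp only [SCT.arcCode, bd_pr]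

theorem bd_strict : SCT.strict.bd = 0 := bd_num 0

theorem bd_weak : SCT.weak.bd = 0 := bd_num 1

namespace Model

open Function

variable {M : Model} {v : ℕ → M.Num} {V : ℕ → M.sets} {d : ℕ}

/-! ### Evaluation of terms -/

/-- A quantifier written at depth `d` rebinds only `v_d`, so terms with bound at most `d` keep their
value underneath it. This is the whole content of capture avoidance. -/
theorem eval_update {t : Term} {i : ℕ} (h : t.bd ≤ i) (a : M.Num) :
    M.eval (update v i a) t = M.eval v t := by
  induction t with
  | var j =>
    simp only [Term.bd] at h
    exact update_of_ne (by omega) _ _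
  | zero => rfl
  | one => rfl
  | add s t ihs iht =>
    simp only [Term.bd, max_le_iff] at h
    simp only [eval, ihs h.1, iht h.2]
  | mul s t ihs iht =>
    simp only [Term.bd, max_le_iff] at h
    simp only [eval, ihs h.1, iht h.2]

@[simp] theorem eval_var (i : ℕ) : M.eval v (.var i) = v i := rfl
@[simp] theorem eval_zero : M.eval v .zero = M.zero := rfl
@[simp] theorem eval_one : M.eval v .one = M.one := rfl
@[simp] theorem eval_add (s t : Term) : M.eval v (.add s t) = M.add (M.eval v s) (M.eval v t) := rfl
@[simp] theorem eval_mul (s t : Term) : M.eval v (.mul s t) = M.mul (M.eval v s) (M.eval v t) := rfl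
@[simp] theorem eval_pr (s t : Term) : M.eval v (SOA.pr s t) = M.pr (M.eval v s) (M.eval v t) := rfl

@[simp] theorem eval_num (k : ℕ) : M.eval v (SOA.num k) = M.num k := by
  induction k with
  | zero => rfl
  | succ k ih => simp only [SOA.num, eval_add, ih, num, eval_one]

@[simp] theorem eval_succ (t : Term) :
    M.eval v (SOA.succ t) = M.add (M.eval v t) M.one := rfl

/-- The arc of kind `r` from `x_x` to `x_y`, in a model. -/
def arc (M : Model) (x r y : M.Num) : M.Num := M.pr x (M.pr r y)

@[simp] theorem eval_arcCode (x r y : Term) :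
    M.eval v (SCT.arcCode x r y) = M.arc (M.eval v x) (M.eval v r) (M.eval v y) := rfl

@[simp] theorem eval_strict : M.eval v SCT.strict = M.num 0 := eval_num 0

@[simp] theorem eval_weak : M.eval v SCT.weak = M.num 1 := eval_num 1

/-! ### Satisfaction of connectives and quantifiers -/

@[simp] theorem sat_eq (s t : Term) : M.Sat v V (SOA.eq s t d) ↔ M.eval v s = M.eval v t := .rfl
@[simp] theorem sat_lt (s t : Term) :
    M.Sat v V (SOA.lt s t d) ↔ M.lt (M.eval v s) (M.eval v t) := .rfl
@[simp] theorem sat_mem (t : Term) (X : ℕ) :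
    M.Sat v V (SOA.mem t X d) ↔ M.eval v t ∈ (V X).1 := .rfl
@[simp] theorem sat_neg (φ : Fml) : M.Sat v V (SOA.neg φ d) ↔ ¬ M.Sat v V (φ d) := .rfl
@[simp] theorem sat_and (φ ψ : Fml) :
    M.Sat v V (SOA.and φ ψ d) ↔ M.Sat v V (φ d) ∧ M.Sat v V (ψ d) := .rfl
@[simp] theorem sat_or (φ ψ : Fml) :
    M.Sat v V (SOA.or φ ψ d) ↔ M.Sat v V (φ d) ∨ M.Sat v V (ψ d) := .rfl
@[simp] theorem sat_imp (φ ψ : Fml) :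
    M.Sat v V (SOA.imp φ ψ d) ↔ (M.Sat v V (φ d) → M.Sat v V (ψ d)) := .rfl
@[simp] theorem sat_iff (φ ψ : Fml) :
    M.Sat v V (SOA.iff φ ψ d) ↔ (M.Sat v V (φ d) ↔ M.Sat v V (ψ d)) := .rfl
@[simp] theorem sat_all (φ : Term → Fml) :
    M.Sat v V (SOA.all φ d) ↔ ∀ a, M.Sat (update v d a) V (φ (.var d) (d + 1)) := .rfl
@[simp] theorem sat_ex (φ : Term → Fml) :
    M.Sat v V (SOA.ex φ d) ↔ ∃ a, M.Sat (update v d a) V (φ (.var d) (d + 1)) := .rfl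
@[simp] theorem sat_allSet (φ : SetVar → Fml) :
    M.Sat v V (SOA.allSet φ d) ↔ ∀ A, M.Sat v (update V d A) (φ d (d + 1)) := .rfl
@[simp] theorem sat_exSet (φ : SetVar → Fml) :
    M.Sat v V (SOA.exSet φ d) ↔ ∃ A, M.Sat v (update V d A) (φ d (d + 1)) := .rfl

/-! ### The notions of the language, in a model -/

/-- `X` is bounded. -/
def IsFinite (M : Model) (X : Set M.Num) : Prop := ∃ b, ∀ x ∈ X, M.lt x b

theorem sat_isFinite {X : ℕ} : M.Sat v V (SOA.isFinite X d) ↔ M.IsFinite (V X).1 := by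
  simp (disch := omega) only [SOA.isFinite, IsFinite, sat_ex, sat_all, sat_imp, sat_mem, sat_lt,
    eval_var, update_self, update_of_ne]

/-- `i` is an element of the finite set with code `c`. -/
def CodeMem (M : Model) (i c : M.Num) : Prop :=
  ∃ k m n, c = M.pr k (M.pr m n) ∧ M.lt i k ∧
    ∃ q, n = M.mul q (M.add (M.mul m (M.add i M.one)) M.one)

/-- The side conditions on `bd` say that the arguments use no variable about to be bound. The same
pattern governs the translations that follow. -/
theorem sat_codeMem {i c : Term} (hi : i.bd ≤ d) (hc : c.bd ≤ d) :
    M.Sat v V (SOA.codeMem i c d) ↔ M.CodeMem (M.eval v i) (M.eval v c) := by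
  simp (disch := (
      try simp only [Term.bd, bd_pr, bd_succ, bd_num, bd_arcCode, bd_strict, bd_weak]
      omega))
    [SOA.codeMem, CodeMem, eval_update, update_of_ne]

/-- `c` is the code of a finite set. -/
def IsCode (M : Model) (c : M.Num) : Prop :=
  ∀ c', M.lt c' c → ¬ ∀ i, M.CodeMem i c' ↔ M.CodeMem i c

theorem sat_isCode {c : Term} (hc : c.bd ≤ d) :
    M.Sat v V (SOA.isCode c d) ↔ M.IsCode (M.eval v c) := by
  simp (disch := (
      try simp only [Term.bd, bd_pr, bd_succ, bd_num, bd_arcCode, bd_strict, bd_weak]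
      omega))
    [SOA.isCode, IsCode, sat_codeMem, eval_update, update_of_ne]

/-- `X` is a function. -/
def IsFunction (M : Model) (X : Set M.Num) : Prop :=
  ∀ n, ∃ y, M.pr n y ∈ X ∧ ∀ z, M.pr n z ∈ X → z = y

theorem sat_isFunction {X : ℕ} :
    M.Sat v V (SOA.isFunction X d) ↔ M.IsFunction (V X).1 := by
  simp (disch := (
      try simp only [Term.bd, bd_pr, bd_succ, bd_num, bd_arcCode, bd_strict, bd_weak]
      omega))
    [SOA.isFunction, SOA.exUnique, IsFunction, update_of_ne]

/-- `f` is a function identifier of arity `n`. -/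
def IsFun (M : Model) (f n : M.Num) : Prop := ∃ a, f = M.pr a n

theorem sat_isFun {f n : Term} (hf : f.bd ≤ d) (hn : n.bd ≤ d) :
    M.Sat v V (SCT.isFun f n d) ↔ M.IsFun (M.eval v f) (M.eval v n) := by
  simp (disch := (
      try simp only [Term.bd, bd_pr, bd_succ, bd_num, bd_arcCode, bd_strict, bd_weak]
      omega))
    [SCT.isFun, IsFun, eval_update]

/-- `G` is a size-change graph `f → g`. -/
def IsGraph (M : Model) (G f g : M.Num) : Prop :=
  ∃ A n m, G = M.pr f (M.pr g A) ∧ M.IsFun f n ∧ M.IsFun g m ∧ M.IsCode A ∧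
    (∀ e, M.CodeMem e A → ∃ x r y, e = M.arc x r y ∧ M.lt x n ∧
      (r = M.num 0 ∨ r = M.num 1) ∧ M.lt y m) ∧
    ∀ x y, ¬ (M.CodeMem (M.arc x (M.num 0) y) A ∧ M.CodeMem (M.arc x (M.num 1) y) A)

theorem sat_isGraph {G f g : Term} (hG : G.bd ≤ d) (hf : f.bd ≤ d) (hg : g.bd ≤ d) :
    M.Sat v V (SCT.isGraph G f g d) ↔ M.IsGraph (M.eval v G) (M.eval v f) (M.eval v g) := by
  simp (disch := (
      try simp only [Term.bd, bd_pr, bd_succ, bd_num, bd_arcCode, bd_strict, bd_weak]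
      omega))
    [SCT.isGraph, IsGraph, sat_codeMem, sat_isCode, sat_isFun, eval_update, update_of_ne]

/-- `G` has an arc of kind `r` from `x` to `y`. -/
def HasArc (M : Model) (G x r y : M.Num) : Prop :=
  ∃ f g A, G = M.pr f (M.pr g A) ∧ M.CodeMem (M.arc x r y) A

theorem sat_hasArc {G x r y : Term} (hG : G.bd ≤ d) (hx : x.bd ≤ d) (hr : r.bd ≤ d) (hy : y.bd ≤ d) :
    M.Sat v V (SCT.hasArc G x r y d) ↔ M.HasArc (M.eval v G) (M.eval v x) (M.eval v r) (M.eval v y) := by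
  simp (disch := (
      try simp only [Term.bd, bd_pr, bd_succ, bd_num, bd_arcCode, bd_strict, bd_weak]
      omega))
    [SCT.hasArc, HasArc, sat_codeMem, eval_update, update_of_ne]

/-- `H = G₀ ; G₁`. -/
def IsComp (M : Model) (H G₀ G₁ : M.Num) : Prop :=
  ∃ f g h, M.IsGraph G₀ f g ∧ M.IsGraph G₁ g h ∧ M.IsGraph H f h ∧ ∀ x z,
    (M.HasArc H x (M.num 0) z ↔ ∃ y r,
      M.HasArc G₀ x (M.num 0) y ∧ M.HasArc G₁ y r z ∨
        M.HasArc G₀ x r y ∧ M.HasArc G₁ y (M.num 0) z) ∧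
    (M.HasArc H x (M.num 1) z ↔ (∃ y, M.HasArc G₀ x (M.num 1) y ∧ M.HasArc G₁ y (M.num 1) z) ∧
      ∀ y r r', M.HasArc G₀ x r y ∧ M.HasArc G₁ y r' z → r = M.num 1 ∧ r' = M.num 1)

theorem sat_isComp {H G₀ G₁ : Term} (hH : H.bd ≤ d) (h₀ : G₀.bd ≤ d) (h₁ : G₁.bd ≤ d) :
    M.Sat v V (SCT.isComp H G₀ G₁ d) ↔ M.IsComp (M.eval v H) (M.eval v G₀) (M.eval v G₁) := by
  simp (disch := (
      try simp only [Term.bd, bd_pr, bd_succ, bd_num, bd_arcCode, bd_strict, bd_weak]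
      omega))
    [SCT.isComp, IsComp, sat_isGraph, sat_hasArc, eval_update, update_of_ne]

/-- `𝒢` is a finite set of size-change graphs. -/
def IsGraphSet (M : Model) (𝒢 : Set M.Num) : Prop :=
  M.IsFinite 𝒢 ∧ ∀ G ∈ 𝒢, ∃ f g, M.IsGraph G f g

theorem sat_isGraphSet {X : ℕ} :
    M.Sat v V (SCT.isGraphSet X d) ↔ M.IsGraphSet (V X).1 := by
  simp (disch := (
      try simp only [Term.bd, bd_pr, bd_succ, bd_num, bd_arcCode, bd_strict, bd_weak]
      omega))
    [SCT.isGraphSet, IsGraphSet, sat_isFinite, sat_isGraph, update_of_ne]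

/-- `G` belongs to the closure of `𝒢` under composition. -/
def InClosure (M : Model) (G : M.Num) (𝒢 : Set M.Num) : Prop :=
  ∀ X : M.sets, ((∀ H, H ∈ 𝒢 → H ∈ X.1) ∧
    ∀ G₀ G₁ H, (G₀ ∈ X.1 ∧ G₁ ∈ X.1 ∧ M.IsComp H G₀ G₁) → H ∈ X.1) → G ∈ X.1

/-- Here a set variable is bound too, so `X < d` is needed for the quantifier over `V_d` to leave 𝒢
intact. -/
theorem sat_inClosure {G : Term} {X : ℕ} (hG : G.bd ≤ d) (hX : X < d) :
    M.Sat v V (SCT.inClosure G X d) ↔ M.InClosure (M.eval v G) (V X).1 := by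
  simp (disch := (
      try simp only [Term.bd, bd_pr, bd_succ, bd_num, bd_arcCode, bd_strict, bd_weak]
      omega))
    [SCT.inClosure, InClosure, sat_isComp, update_of_ne]

/-- `F` is an infinite multipath. -/
def IsMultipath (M : Model) (F : Set M.Num) : Prop :=
  M.IsFunction F ∧ ∀ n G G', M.pr n G ∈ F ∧ M.pr (M.add n M.one) G' ∈ F →
    ∃ f g h, M.IsGraph G f g ∧ M.IsGraph G' g h

theorem sat_isMultipath {X : ℕ} :
    M.Sat v V (SCT.isMultipath X d) ↔ M.IsMultipath (V X).1 := by
  simp (disch := (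
      try simp only [Term.bd, bd_pr, bd_succ, bd_num, bd_arcCode, bd_strict, bd_weak]
      omega))
    [SCT.isMultipath, IsMultipath, sat_isFunction, sat_isGraph, update_of_ne]

/-- The multipath `F` has infinite descent. -/
def HasInfiniteDescent (M : Model) (F : Set M.Num) : Prop :=
  ∃ t, ∃ T : M.sets, M.IsFunction T.1 ∧
    (∀ i G x y, M.pr (M.add t i) G ∈ F ∧ M.pr i x ∈ T.1 ∧ M.pr (M.add i M.one) y ∈ T.1 →
      ∃ r, M.HasArc G x r y) ∧
    ∀ b, ∃ i, M.lt b i ∧ ∃ G x y, M.pr (M.add t i) G ∈ F ∧ M.pr i x ∈ T.1 ∧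
      M.pr (M.add i M.one) y ∈ T.1 ∧ M.HasArc G x (M.num 0) y

theorem sat_hasInfiniteDescent {X : ℕ} (hX : X < d) :
    M.Sat v V (SCT.hasInfiniteDescent X d) ↔ M.HasInfiniteDescent (V X).1 := by
  simp (disch := (
      try simp only [Term.bd, bd_pr, bd_succ, bd_num, bd_arcCode, bd_strict, bd_weak]
      omega))
    [SCT.hasInfiniteDescent, HasInfiniteDescent, sat_isFunction, sat_hasArc, update_of_ne]

/-- `𝒢` satisfies the criterion for size-change termination. -/
def CriterionFor (M : Model) (𝒢 : Set M.Num) : Prop :=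
  (∀ F : M.sets, (M.IsMultipath F.1 ∧ ∀ n G, M.pr n G ∈ F.1 → G ∈ 𝒢) →
    M.HasInfiniteDescent F.1) ↔
  ∀ G, M.InClosure G 𝒢 ∧ M.IsComp G G G → ∃ x, M.HasArc G x (M.num 0) x

theorem sat_criterionFor {X : ℕ} (hX : X < d) :
    M.Sat v V (SCT.criterionFor X d) ↔ M.CriterionFor (V X).1 := by
  simp (disch := (
      try simp only [Term.bd, bd_pr, bd_succ, bd_num, bd_arcCode, bd_strict, bd_weak]
      omega))
    [SCT.criterionFor, SCT.isSCT, SCT.isIdempotent, CriterionFor, sat_isMultipath,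
    sat_hasInfiniteDescent, sat_inClosure, sat_isComp, sat_hasArc, update_of_ne]

end Model
end SOA

namespace SOA.Model

open Function

variable {M : Model} {v : ℕ → M.Num} {V : ℕ → M.sets} {d : ℕ}

/-! ### Programs, in a model -/

/-- `(p, (f, l)) ∈ L`. -/
def IsNode (M : Model) (L : Set M.Num) (p f l : M.Num) : Prop := M.pr p (M.pr f l) ∈ L

/-- `(p, (j, c)) ∈ C`. -/
def IsChild (M : Model) (C : Set M.Num) (p j c : M.Num) : Prop := M.pr p (M.pr j c) ∈ C

/-- The node `p` has a label of the form `(k, a)`. -/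
def HasTag (M : Model) (L : Set M.Num) (p : M.Num) (k : ℕ) : Prop :=
  ∃ f a, M.IsNode L p f (M.pr (M.num k) a)

theorem sat_hasTag {L : ℕ} {p : Term} {k : ℕ} (hp : p.bd ≤ d) :
    M.Sat v V (SCT.hasTag L p k d) ↔ M.HasTag (V L).1 (M.eval v p) k := by
  simp (disch := (
      try simp only [Term.bd, bd_pr, bd_succ, bd_num, bd_arcCode, bd_strict, bd_weak]
      omega))
    [SCT.hasTag, SCT.isNode, HasTag, IsNode, eval_update, update_of_ne]

/-- `p` is an arithmetic expression. -/
def IsArith (M : Model) (L : Set M.Num) (p : M.Num) : Prop :=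
  M.HasTag L p 0 ∨ M.HasTag L p 1 ∨ M.HasTag L p 2 ∨ M.HasTag L p 3 ∨ M.HasTag L p 4

theorem sat_isArith {L : ℕ} {p : Term} (hp : p.bd ≤ d) :
    M.Sat v V (SCT.isArith L p d) ↔ M.IsArith (V L).1 (M.eval v p) := by
  simp only [SCT.isArith, IsArith, sat_or, sat_hasTag hp]

/-- `p` is a boolean expression. -/
def IsBool (M : Model) (L : Set M.Num) (p : M.Num) : Prop :=
  M.HasTag L p 5 ∨ M.HasTag L p 6 ∨ M.HasTag L p 7 ∨ M.HasTag L p 8 ∨ M.HasTag L p 9 ∨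
    M.HasTag L p 10 ∨ M.HasTag L p 11

theorem sat_isBool {L : ℕ} {p : Term} (hp : p.bd ≤ d) :
    M.Sat v V (SCT.isBool L p d) ↔ M.IsBool (V L).1 (M.eval v p) := by
  simp only [SCT.isBool, IsBool, sat_or, sat_hasTag hp]

/-- `p` is an expression. -/
def IsExpr (M : Model) (L : Set M.Num) (p : M.Num) : Prop := M.IsArith L p ∨ M.HasTag L p 12

theorem sat_isExpr {L : ℕ} {p : Term} (hp : p.bd ≤ d) :
    M.Sat v V (SCT.isExpr L p d) ↔ M.IsExpr (V L).1 (M.eval v p) := by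
  simp only [SCT.isExpr, IsExpr, sat_or, sat_isArith hp, sat_hasTag hp]

/-- `p` has exactly the children number `0, …, k - 1`, and `Q j c` holds for the `j`-th child. -/
def HasChildren (M : Model) (C : Set M.Num) (p k : M.Num) (Q : M.Num → M.Num → Prop) : Prop :=
  (∀ j c, M.IsChild C p j c → M.lt j k ∧ Q j c) ∧
    ∀ j, M.lt j k → ∃ c, M.IsChild C p j c ∧ ∀ c', M.IsChild C p j c' → c' = c

/-- Since `Q` is an arbitrary function from terms to formulas, its meaning has to be supplied at
exactly the fresh variables and the depth at which it is instantiated. -/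
theorem sat_hasChildren {C : ℕ} {p k : Term} {Q : Term → Term → Fml} {Q' : M.Num → M.Num → Prop}
    (hp : p.bd ≤ d) (hk : k.bd ≤ d)
    (hQ : ∀ j c, M.Sat (update (update v d j) (d + 1) c) V
      (Q (.var d) (.var (d + 1)) (d + 1 + 1)) ↔ Q' j c) :
    M.Sat v V (SCT.hasChildren C p k Q d) ↔
      M.HasChildren (V C).1 (M.eval v p) (M.eval v k) Q' := by
  simp (disch := (
      try simp only [Term.bd, bd_pr, bd_succ, bd_num, bd_arcCode, bd_strict, bd_weak]
      omega))
    [SCT.hasChildren, SCT.isChild, SOA.exUnique, HasChildren, IsChild, eval_update, update_of_ne, hQ]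

/-- `p` is a leaf. -/
def IsLeaf (M : Model) (C : Set M.Num) (p : M.Num) : Prop := ∀ j c, ¬ M.IsChild C p j c

theorem sat_isLeaf {C : ℕ} {p : Term} (hp : p.bd ≤ d) :
    M.Sat v V (SCT.isLeaf C p d) ↔ M.IsLeaf (V C).1 (M.eval v p) := by
  simp (disch := (
      try simp only [Term.bd, bd_pr, bd_succ, bd_num, bd_arcCode, bd_strict, bd_weak]
      omega))
    [SCT.isLeaf, SCT.isChild, IsLeaf, IsChild, eval_update, update_of_ne]

/-- `f` is a function of the program. -/
def IsFunctionOf (M : Model) (R : Set M.Num) (f : M.Num) : Prop := ∃ p, M.pr f p ∈ R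

theorem sat_isFunctionOf {R : ℕ} {f : Term} (hf : f.bd ≤ d) :
    M.Sat v V (SCT.isFunctionOf R f d) ↔ M.IsFunctionOf (V R).1 (M.eval v f) := by
  simp (disch := (
      try simp only [Term.bd, bd_pr, bd_succ, bd_num, bd_arcCode, bd_strict, bd_weak]
      omega))
    [SCT.isFunctionOf, SCT.isRoot, IsFunctionOf, eval_update]

/-- The node `p` with label `l` in the body of `f` obeys the grammar. -/
def ObeysGrammar (M : Model) (L C R : Set M.Num) (p f l : M.Num) : Prop :=
  ∃ n, M.IsFun f n ∧
    ((∃ i, M.lt i n ∧ (l = M.pr (M.num 0) i ∨ l = M.pr (M.num 1) i ∨ l = M.pr (M.num 2) i) ∧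
        M.IsLeaf C p) ∨
     (∃ o k, l = M.pr (M.num 3) (M.pr o k) ∧ M.HasChildren C p k fun _ c => M.IsArith L c) ∨
     (∃ g m, l = M.pr (M.num 4) g ∧ M.IsFunctionOf R g ∧ M.IsFun g m ∧
        M.HasChildren C p m fun _ c => M.IsArith L c) ∨
     (∃ i, M.lt i n ∧ (l = M.pr (M.num 5) i ∨ l = M.pr (M.num 6) i) ∧ M.IsLeaf C p) ∨
     (∃ i j, M.lt i n ∧ M.lt j n ∧
        (l = M.pr (M.num 7) (M.pr i j) ∨ l = M.pr (M.num 8) (M.pr i j)) ∧ M.IsLeaf C p) ∨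
     ((l = M.pr (M.num 9) (M.num 0) ∨ l = M.pr (M.num 10) (M.num 0)) ∧
        M.HasChildren C p (M.num 2) fun _ c => M.IsBool L c) ∨
     (l = M.pr (M.num 11) (M.num 0) ∧ M.HasChildren C p (M.num 1) fun _ c => M.IsBool L c) ∨
     (l = M.pr (M.num 12) (M.num 0) ∧ M.HasChildren C p (M.num 3) fun j c =>
        (j = M.num 0 ∧ M.IsBool L c) ∨ (¬ j = M.num 0 ∧ M.IsExpr L c)))

/-- This and the next two lemmas settle the hypothesis on `Q` for the conditions that occur in the
grammar, so that they can serve as rewrite rules in `sat_obeysGrammar`. -/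
theorem sat_hasChildren_isArith {L C : ℕ} {p k : Term} (hp : p.bd ≤ d) (hk : k.bd ≤ d) :
    M.Sat v V (SCT.hasChildren C p k (fun _ c => SCT.isArith L c) d) ↔
      M.HasChildren (V C).1 (M.eval v p) (M.eval v k) fun _ c => M.IsArith (V L).1 c :=
  sat_hasChildren hp hk fun j c => by
    rw [sat_isArith (by simp only [Term.bd]; omega), eval_var, update_self]

theorem sat_hasChildren_isBool {L C : ℕ} {p k : Term} (hp : p.bd ≤ d) (hk : k.bd ≤ d) :
    M.Sat v V (SCT.hasChildren C p k (fun _ c => SCT.isBool L c) d) ↔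
      M.HasChildren (V C).1 (M.eval v p) (M.eval v k) fun _ c => M.IsBool (V L).1 c :=
  sat_hasChildren hp hk fun j c => by
    rw [sat_isBool (by simp only [Term.bd]; omega), eval_var, update_self]

theorem sat_hasChildren_ite {L C : ℕ} {p k : Term} (hp : p.bd ≤ d) (hk : k.bd ≤ d) :
    M.Sat v V (SCT.hasChildren C p k (fun j c => SOA.or
      (SOA.and (SOA.eq j (SOA.num 0)) (SCT.isBool L c))
      (SOA.and (SOA.neg (SOA.eq j (SOA.num 0))) (SCT.isExpr L c))) d) ↔
      M.HasChildren (V C).1 (M.eval v p) (M.eval v k) fun j c =>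
        (j = M.num 0 ∧ M.IsBool (V L).1 c) ∨ (¬ j = M.num 0 ∧ M.IsExpr (V L).1 c) :=
  sat_hasChildren hp hk fun j c => by
    simp (disch := (
      try simp only [Term.bd]
      omega)) only [sat_or, sat_and, sat_neg, sat_eq, sat_isBool, sat_isExpr, eval_var,
      eval_num, update_self, update_of_ne]

theorem sat_obeysGrammar {L C R : ℕ} {p f l : Term} (hp : p.bd ≤ d) (hf : f.bd ≤ d)
    (hl : l.bd ≤ d) :
    M.Sat v V (SCT.obeysGrammar L C R p f l d) ↔
      M.ObeysGrammar (V L).1 (V C).1 (V R).1 (M.eval v p) (M.eval v f) (M.eval v l) := by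
  simp (disch := (
      try simp only [Term.bd, bd_pr, bd_succ, bd_num, bd_arcCode, bd_strict, bd_weak]
      omega)) only
    [SCT.obeysGrammar, ObeysGrammar, sat_ex, sat_and, sat_or, sat_eq, sat_lt, eval_var, eval_num,
      eval_pr, update_self, eval_update, update_of_ne, sat_hasChildren_isArith,
      sat_hasChildren_isBool, sat_hasChildren_ite, sat_isLeaf, sat_isFun, sat_isFunctionOf]

/-- `(L, C, R, f₀)` is a program with initial function `f₀`. -/
def IsProgram (M : Model) (L C R : Set M.Num) (f₀ : M.Num) : Prop :=
  M.IsFinite L ∧ M.IsFinite C ∧ M.IsFinite R ∧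
  (∀ p f l, M.IsNode L p f l →
    (∀ f' l', M.IsNode L p f' l' → f' = f ∧ l' = l) ∧ M.ObeysGrammar L C R p f l) ∧
  (∀ p f l, M.IsNode L p f l → M.pr f p ∈ R ∨ ∃ q j, M.IsChild C q j p) ∧
  (∀ p j c, M.IsChild C p j c → M.lt p c ∧
    (∃ f l l', M.IsNode L p f l ∧ M.IsNode L c f l') ∧
    ∀ q i, M.IsChild C q i c → q = p ∧ i = j) ∧
  (∀ f p, M.pr f p ∈ R → (∃ n, M.IsFun f n) ∧ (∀ p', M.pr f p' ∈ R → p' = p) ∧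
    (∃ l, M.IsNode L p f l) ∧ M.IsExpr L p ∧ ∀ q j, ¬ M.IsChild C q j p) ∧
  M.IsFunctionOf R f₀

theorem sat_isProgram {L C R : ℕ} {f₀ : Term} (hf : f₀.bd ≤ d) :
    M.Sat v V (SCT.isProgram L C R f₀ d) ↔
      M.IsProgram (V L).1 (V C).1 (V R).1 (M.eval v f₀) := by
  simp (disch := (
      try simp only [Term.bd, bd_pr, bd_succ, bd_num, bd_arcCode, bd_strict, bd_weak]
      omega)) only
    [SCT.isProgram, IsProgram, sat_ex, sat_all, sat_imp, sat_neg, sat_and, sat_or, sat_eq, sat_lt,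
      eval_var, update_self, update_of_ne, sat_isFinite, sat_obeysGrammar, sat_isExpr, sat_isFun,
      sat_isFunctionOf, SCT.isNode, SCT.isChild, SCT.isRoot, IsNode, IsChild, sat_mem, eval_pr]

/-- `𝒢` is a description of the program with node labels `L`. -/
def IsDescription (M : Model) (𝒢 L : Set M.Num) : Prop :=
  M.IsGraphSet 𝒢 ∧ ∃ D : M.sets,
    (∀ τ f g, M.IsNode L τ f (M.pr (M.num 4) g) →
      (∃ G, M.pr τ G ∈ D.1 ∧ ∀ G', M.pr τ G' ∈ D.1 → G' = G) ∧
        ∀ G, M.pr τ G ∈ D.1 → G ∈ 𝒢 ∧ M.IsGraph G f g) ∧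
    ∀ G, G ∈ 𝒢 → ∃ τ f g, M.IsNode L τ f (M.pr (M.num 4) g) ∧ M.pr τ G ∈ D.1

theorem sat_isDescription {X L : ℕ} (hX : X < d) (hL : L < d) :
    M.Sat v V (SCT.isDescription X L d) ↔ M.IsDescription (V X).1 (V L).1 := by
  simp (disch := (
      try simp only [Term.bd, bd_pr, bd_succ, bd_num, bd_arcCode, bd_strict, bd_weak]
      omega)) only
    [SCT.isDescription, IsDescription, SOA.exUnique, sat_ex, sat_exSet, sat_all, sat_imp, sat_and,
      sat_eq, eval_var, update_self, update_of_ne, sat_isGraphSet, sat_isGraph, SCT.isCall,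
      SCT.isNode, IsNode, sat_mem, eval_pr, eval_num]

theorem sat_sctCriterion : M.Sat v V (SCT.sctCriterion d) ↔
    ∀ (L C R : M.sets) (f₀ : M.Num) (𝒢 : M.sets),
      M.IsProgram L.1 C.1 R.1 f₀ ∧ M.IsDescription 𝒢.1 L.1 → M.CriterionFor 𝒢.1 := by
  simp (disch := (
      try simp only [Term.bd, bd_pr, bd_succ, bd_num, bd_arcCode, bd_strict, bd_weak]
      omega)) only
    [SCT.sctCriterion, sat_allSet, sat_all, sat_imp, sat_and, sat_isProgram, sat_isDescription,
      sat_criterionFor, eval_var, update_self, update_of_ne]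

theorem sat_sctCriterionForGraphs : M.Sat v V (SCT.sctCriterionForGraphs d) ↔
    ∀ 𝒢 : M.sets, M.IsGraphSet 𝒢.1 → M.CriterionFor 𝒢.1 := by
  simp (disch := (
      try simp only [Term.bd, bd_pr, bd_succ, bd_num, bd_arcCode, bd_strict, bd_weak]
      omega)) only
    [SCT.sctCriterionForGraphs, sat_allSet, sat_imp, sat_isGraphSet, sat_criterionFor, update_self]

end SOA.Model

/-! ### The program associated with a finite set of graphs -/

namespace SOA

/-- The bounded existential quantifier. -/
def exLt (t : Term) (φ : Term → Fml) : Fml := ex fun x => lt x t ⋏ φ x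

theorem Term.lt_bd_of_uses {t : Term} {x : ℕ} (h : t.Uses x) : x < t.bd := by
  induction t with
  | var i => exact Nat.lt_succ_of_le (Eq.ge h)
  | zero => exact h.elim
  | one => exact h.elim
  | add s t ihs iht => exact lt_max_iff.2 (h.imp ihs iht)
  | mul s t ihs iht => exact lt_max_iff.2 (h.imp ihs iht)

theorem isDelta0_exLt {t : Term} {φ : Term → Fml} {d : ℕ} (ht : t.bd ≤ d)
    (hφ : (φ (.var d) (d + 1)).IsDelta0) : (exLt t φ d).IsDelta0 :=
  .exLt (fun h => absurd (Term.lt_bd_of_uses h) (not_lt.2 ht)) hφ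

namespace Model

open Function

variable {M : Model}

/-- The codes `(f, (j, i))` of nodes: `(f, (0, 0))` is the root of the body of `f`, its `j`-th child
is `(f, (j + 1, 0))`, and the `i`-th child of the latter is `(f, (j + 1, i + 1))`. -/
def node (M : Model) (f j i : M.Num) : M.Num := M.pr f (M.pr j i)

/-- `f` is a function identifier below `b`. -/
def FunLt (M : Model) (b f : M.Num) : Prop := M.lt f b ∧ ∃ n, M.IsFun f n

/-- `G` is a member of `𝒢` with source `f` and target `g`. -/
def Link (M : Model) (𝒢 : Set M.Num) (f G g : M.Num) : Prop := G ∈ 𝒢 ∧ ∃ A, G = M.pr f (M.pr g A)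

/-- The labelled nodes of the program associated with `𝒢` and the bound `b`. -/
def NodeOf (M : Model) (𝒢 : Set M.Num) (b p f l : M.Num) : Prop :=
  (M.FunLt b f ∧ p = M.node f M.zero M.zero ∧ l = M.pr (M.num 3) (M.pr M.zero b)) ∨
  (∃ j, M.FunLt b f ∧ M.lt j b ∧ p = M.node f (M.add j M.one) M.zero ∧
    ((∃ g, M.Link 𝒢 f j g ∧ l = M.pr (M.num 4) g) ∨
      ((¬ ∃ g, M.Link 𝒢 f j g) ∧ l = M.pr (M.num 3) (M.pr M.zero M.zero)))) ∨
  ∃ G g m i, M.Link 𝒢 f G g ∧ M.IsFun g m ∧ M.lt i m ∧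
    p = M.node f (M.add G M.one) (M.add i M.one) ∧ l = M.pr (M.num 3) (M.pr M.zero M.zero)

/-- The children in the program associated with `𝒢` and `b`. -/
def ChildOf (M : Model) (𝒢 : Set M.Num) (b p j c : M.Num) : Prop :=
  (∃ f, M.FunLt b f ∧ M.lt j b ∧ p = M.node f M.zero M.zero ∧
    c = M.node f (M.add j M.one) M.zero) ∨
  ∃ f G g m, M.Link 𝒢 f G g ∧ M.IsFun g m ∧ M.lt j m ∧
    p = M.node f (M.add G M.one) M.zero ∧ c = M.node f (M.add G M.one) (M.add j M.one)

/-- The roots in the program associated with `𝒢` and `b`. -/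
def RootOf (M : Model) (b f p : M.Num) : Prop := M.FunLt b f ∧ p = M.node f M.zero M.zero

/-- The assignment of the members of `𝒢` to the calls of the program associated with `𝒢`. -/
def GraphOf (M : Model) (𝒢 : Set M.Num) (τ G : M.Num) : Prop :=
  ∃ f g, M.Link 𝒢 f G g ∧ τ = M.node f (M.add G M.one) M.zero

theorem exists_link {𝒢 : M.sets} (h𝒢 : ∀ G ∈ 𝒢.1, ∃ f g, M.IsGraph G f g) {G : M.Num} (hG : G ∈ 𝒢.1) :
    ∃ f g, M.Link 𝒢.1 f G g := by
  obtain ⟨f, g, A, n, m, hA, -⟩ := h𝒢 G hG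
  exact ⟨f, g, hG, A, hA⟩

namespace IsModelRCA0

variable (hM : M.IsModelRCA0) {𝒢 : M.sets} {b : M.Num}
include hM

theorem isFun_inj {f m n : M.Num} (hm : M.IsFun f m) (hn : M.IsFun f n) : m = n := by
  obtain ⟨a, rfl⟩ := hm
  obtain ⟨a', h⟩ := hn
  exact (hM.pr_inj.1 h).2

/-- Source and target are components of the code of a graph. -/
theorem link_inj {G f g f' g' : M.Num} (h : M.Link 𝒢.1 f G g) (h' : M.Link 𝒢.1 f' G g') :
    f = f' ∧ g = g' := by
  obtain ⟨-, A, rfl⟩ := h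
  obtain ⟨-, A', h'⟩ := h'
  have := hM.pr_inj.1 h'
  exact ⟨this.1, (hM.pr_inj.1 this.2).1⟩

theorem lt_of_isFun {f n : M.Num} (h : M.IsFun f n) (hf : M.lt f b) : M.lt n b := by
  obtain ⟨a, rfl⟩ := h
  exact (hM.lt_of_pr_lt hf).2

theorem lt_of_link (hb : ∀ G ∈ 𝒢.1, M.lt G b) {f G g : M.Num} (h : M.Link 𝒢.1 f G g) :
    M.lt f b ∧ M.lt G b ∧ M.lt g b := by
  obtain ⟨hG, A, rfl⟩ := h
  have h1 := hM.lt_of_pr_lt (hb _ hG)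
  exact ⟨h1.1, hb _ hG, (hM.lt_of_pr_lt h1.2).1⟩

theorem isGraph_of_link (h𝒢 : ∀ G ∈ 𝒢.1, ∃ f g, M.IsGraph G f g) {f G g : M.Num}
    (h : M.Link 𝒢.1 f G g) : M.IsGraph G f g := by
  obtain ⟨f', g', hG⟩ := h𝒢 G h.1
  have h' : M.Link 𝒢.1 f' G g' := by
    obtain ⟨A, n, m, hA, -⟩ := hG
    exact ⟨h.1, A, hA⟩
  obtain ⟨rfl, rfl⟩ := hM.link_inj h h'
  exact hG

theorem exists_isFun_of_link (h𝒢 : ∀ G ∈ 𝒢.1, ∃ f g, M.IsGraph G f g)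
    {f G g : M.Num} (h : M.Link 𝒢.1 f G g) : (∃ n, M.IsFun f n) ∧ ∃ m, M.IsFun g m := by
  obtain ⟨A, n, m, -, hn, hm, -⟩ := hM.isGraph_of_link h𝒢 h
  exact ⟨⟨n, hn⟩, m, hm⟩

theorem funLt_of_link (h𝒢 : ∀ G ∈ 𝒢.1, ∃ f g, M.IsGraph G f g) (hb : ∀ G ∈ 𝒢.1, M.lt G b)
    {f G g : M.Num} (h : M.Link 𝒢.1 f G g) : M.FunLt b f ∧ M.FunLt b g :=
  ⟨⟨(hM.lt_of_link hb h).1, (hM.exists_isFun_of_link h𝒢 h).1⟩,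
    (hM.lt_of_link hb h).2.2, (hM.exists_isFun_of_link h𝒢 h).2⟩

/-- Name and arity are components of `f < b`, so bounding them by `b` loses nothing; `link_iff` does
the same for the arc set of a graph. -/
theorem funLt_iff {f : M.Num} :
    (∃ a, M.lt a b ∧ ∃ n, M.lt n b ∧ f = M.pr a n) ∧ M.lt f b ↔ M.FunLt b f := by
  constructor
  · rintro ⟨⟨a, -, n, -, h⟩, hf⟩
    exact ⟨hf, n, a, h⟩
  · rintro ⟨hf, n, a, rfl⟩
    have := hM.lt_of_pr_lt hf
    exact ⟨⟨a, this.1, n, this.2, rfl⟩, hf⟩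

theorem link_iff (hb : ∀ G ∈ 𝒢.1, M.lt G b) {f G g : M.Num} :
    (G ∈ 𝒢.1 ∧ ∃ A, M.lt A b ∧ G = M.pr f (M.pr g A)) ↔ M.Link 𝒢.1 f G g := by
  constructor
  · rintro ⟨hG, A, -, h⟩
    exact ⟨hG, A, h⟩
  · rintro ⟨hG, A, rfl⟩
    exact ⟨hG, A, (hM.lt_of_pr_lt (hM.lt_of_pr_lt (hb _ hG)).2).2, rfl⟩

end IsModelRCA0

end Model

/-! ### Bounded quantifier formulas for the associated program

The variable `v₁` stands for the bound `b` and `V₀` for the set `𝒢`. -/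

/-- The code of a node, as a term. -/
def nodeTerm (f j i : Term) : Term := pr f (pr j i)

def funLtFml (f : Term) : Fml :=
  (exLt (.var 1) fun a => exLt (.var 1) fun n => f ≐ pr a n) ⋏ f ≺ .var 1

def linkFml (f G g : Term) : Fml := G ∊ 0 ⋏ exLt (.var 1) fun A => G ≐ pr f (pr g A)

def isFunFml (f n : Term) : Fml := exLt (.var 1) fun a => f ≐ pr a n

/-- The quantifiers range over functions, graphs, arities and positions, all below `b`. Codes of
nodes and labels may exceed `b`; they are therefore not quantified but replaced by explicit terms in
an equation for `x`. -/
def nodeFml (x : Term) : Fml := exLt (.var 1) fun f =>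
  (funLtFml f ⋏ x ≐ pr (nodeTerm f .zero .zero) (pr f (pr (num 3) (pr .zero (.var 1))))) ⋎
  (exLt (.var 1) fun j => funLtFml f ⋏
    ((exLt (.var 1) fun g => linkFml f j g ⋏
        x ≐ pr (nodeTerm f (succ j) .zero) (pr f (pr (num 4) g))) ⋎
      (∼(exLt (.var 1) fun g => linkFml f j g) ⋏
        x ≐ pr (nodeTerm f (succ j) .zero) (pr f (pr (num 3) (pr .zero .zero)))))) ⋎
  exLt (.var 1) fun G => exLt (.var 1) fun g => exLt (.var 1) fun m => exLt (.var 1) fun i =>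
    linkFml f G g ⋏ isFunFml g m ⋏ i ≺ m ⋏
      x ≐ pr (nodeTerm f (succ G) (succ i)) (pr f (pr (num 3) (pr .zero .zero)))

def childFml (x : Term) : Fml := exLt (.var 1) fun f => exLt (.var 1) fun j =>
  (funLtFml f ⋏ x ≐ pr (nodeTerm f .zero .zero) (pr j (nodeTerm f (succ j) .zero))) ⋎
  exLt (.var 1) fun G => exLt (.var 1) fun g => exLt (.var 1) fun m =>
    linkFml f G g ⋏ isFunFml g m ⋏ j ≺ m ⋏
      x ≐ pr (nodeTerm f (succ G) .zero) (pr j (nodeTerm f (succ G) (succ j)))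

def rootFml (x : Term) : Fml := exLt (.var 1) fun f =>
  funLtFml f ⋏ x ≐ pr f (nodeTerm f .zero .zero)

def graphFml (x : Term) : Fml := exLt (.var 1) fun f => exLt (.var 1) fun G =>
  exLt (.var 1) fun g => linkFml f G g ⋏ x ≐ pr (nodeTerm f (succ G) .zero) G

namespace Model

open Function

variable {M : Model} {v : ℕ → M.Num} {V : ℕ → M.sets} {d : ℕ}

@[simp] theorem eval_nodeTerm (f j i : Term) :
    M.eval v (nodeTerm f j i) = M.node (M.eval v f) (M.eval v j) (M.eval v i) := rfl

theorem sat_exLt {t : Term} {φ : Term → Fml} (ht : t.bd ≤ d) :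
    M.Sat v V (exLt t φ d) ↔
      ∃ a, M.lt a (M.eval v t) ∧ M.Sat (update v d a) V (φ (.var d) (d + 1)) := by
  simp only [exLt, sat_ex, sat_and, sat_lt, eval_var, update_self, eval_update ht]

theorem sat_isFunFml {f n : Term} (hd : 1 < d) (hf : f.bd ≤ d) (hn : n.bd ≤ d) :
    M.Sat v V (isFunFml f n d) ↔ ∃ a, M.lt a (v 1) ∧ M.eval v f = M.pr a (M.eval v n) := by
  simp (disch := (
      try simp only [Term.bd]
      omega)) only
    [isFunFml, sat_exLt, sat_eq, eval_var, eval_pr, update_self, eval_update]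

namespace IsModelRCA0

variable (hM : M.IsModelRCA0)
include hM

theorem sat_funLtFml {f : Term} (hd : 1 < d) (hf : f.bd ≤ d) :
    M.Sat v V (funLtFml f d) ↔ M.FunLt (v 1) (M.eval v f) := by
  rw [← hM.funLt_iff]
  simp (disch := (
      try simp only [Term.bd, bd_pr, bd_succ, bd_num]
      omega)) only
    [funLtFml, sat_exLt, sat_and, sat_eq, sat_lt, eval_var, eval_pr, update_self, eval_update,
      update_of_ne]

theorem sat_linkFml {f G g : Term} (hd : 1 < d) (hf : f.bd ≤ d) (hG : G.bd ≤ d) (hg : g.bd ≤ d)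
    (hb : ∀ G ∈ (V 0).1, M.lt G (v 1)) :
    M.Sat v V (linkFml f G g d) ↔ M.Link (V 0).1 (M.eval v f) (M.eval v G) (M.eval v g) := by
  rw [← hM.link_iff hb]
  simp (disch := (
      try simp only [Term.bd, bd_pr, bd_succ, bd_num]
      omega)) only
    [linkFml, sat_exLt, sat_and, sat_eq, sat_mem, eval_var, eval_pr, update_self, eval_update]

end IsModelRCA0

theorem isDelta0_funLtFml {f : Term} (hd : 1 < d) : (funLtFml f d).IsDelta0 :=
  .and (isDelta0_exLt hd (isDelta0_exLt (Nat.lt_succ_of_lt hd) (.eq _ _))) (.lt _ _)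

theorem isDelta0_linkFml {f G g : Term} (hd : 1 < d) : (linkFml f G g d).IsDelta0 :=
  .and (.mem _ _) (isDelta0_exLt hd (.eq _ _))

theorem isDelta0_isFunFml {f n : Term} (hd : 1 < d) : (isFunFml f n d).IsDelta0 :=
  isDelta0_exLt hd (.eq _ _)

/-- The depth is 3 because `v₀` is the candidate element, `v₁` the bound `b` and `v₂` the dummy
variable of comprehension. -/
theorem isDelta0_nodeFml : (nodeFml (.var 0) 3).IsDelta0 := by
  have h : ∀ n, (Term.var 1).bd ≤ n + 3 := fun n => by simp only [Term.bd]; omega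
  have h' : ∀ n, 1 < n + 3 := by omega
  refine isDelta0_exLt (h 0) (.or (.and (isDelta0_funLtFml (h' 1)) (.eq _ _)) (.or
    (isDelta0_exLt (h 1) (.and (isDelta0_funLtFml (h' 2)) (.or
      (isDelta0_exLt (h 2) (.and (isDelta0_linkFml (h' 3)) (.eq _ _)))
      (.and (.neg (isDelta0_exLt (h 2) (isDelta0_linkFml (h' 3)))) (.eq _ _)))))
    (isDelta0_exLt (h 1) (isDelta0_exLt (h 2) (isDelta0_exLt (h 3) (isDelta0_exLt (h 4)
      (.and (isDelta0_linkFml (h' 5)) (.and (isDelta0_isFunFml (h' 5))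
        (.and (.lt _ _) (.eq _ _))))))))))

theorem isDelta0_childFml : (childFml (.var 0) 3).IsDelta0 := by
  have h : ∀ n, (Term.var 1).bd ≤ n + 3 := fun n => by simp only [Term.bd]; omega
  have h' : ∀ n, 1 < n + 3 := by omega
  exact isDelta0_exLt (h 0) (isDelta0_exLt (h 1)
    (.or (.and (isDelta0_funLtFml (h' 2)) (.eq _ _))
    (isDelta0_exLt (h 2) (isDelta0_exLt (h 3) (isDelta0_exLt (h 4)
      (.and (isDelta0_linkFml (h' 5)) (.and (isDelta0_isFunFml (h' 5))
        (.and (.lt _ _) (.eq _ _)))))))))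

theorem isDelta0_rootFml : (rootFml (.var 0) 3).IsDelta0 := by
  have h : ∀ n, (Term.var 1).bd ≤ n + 3 := fun n => by simp only [Term.bd]; omega
  have h' : ∀ n, 1 < n + 3 := by omega
  exact isDelta0_exLt (h 0) (.and (isDelta0_funLtFml (h' 1)) (.eq _ _))

theorem isDelta0_graphFml : (graphFml (.var 0) 3).IsDelta0 := by
  have h : ∀ n, (Term.var 1).bd ≤ n + 3 := fun n => by simp only [Term.bd]; omega
  have h' : ∀ n, 1 < n + 3 := by omega
  exact isDelta0_exLt (h 0) (isDelta0_exLt (h 1) (isDelta0_exLt (h 2)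
    (.and (isDelta0_linkFml (h' 3)) (.eq _ _))))

/-! ### Existence of the components by comprehension -/

namespace IsModelRCA0

variable (hM : M.IsModelRCA0) {𝒢 : M.sets} {b : M.Num}
include hM

theorem exists_roots : ∃ R : M.sets,
    (∀ x ∈ R.1, ∃ f p, x = M.pr f p ∧ M.RootOf b f p) ∧
      ∀ f p, M.pr f p ∈ R.1 ↔ M.RootOf b f p := by
  -- The formula for roots mentions no set; an arbitrary one fills the assignment.
  obtain ⟨A, hA⟩ := M.sets_nonempty
  obtain ⟨R, hR⟩ := hM.delta0_comprehension (P := fun x => ∃ f p, x = M.pr f p ∧ M.RootOf b f p)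
    (rootFml (.var 0) 3) isDelta0_rootFml (fun _ => b) (fun _ => ⟨A, hA⟩) 0 2 (fun x c => by
      simp (disch := (
          try simp only [Term.bd]
          omega)) only [rootFml, sat_exLt, sat_and, sat_eq, hM.sat_funLtFml, eval_var, eval_pr,
          eval_nodeTerm, eval_zero, update_self, update_of_ne]
      constructor
      · rintro ⟨f, -, hf, rfl⟩
        exact ⟨f, _, rfl, hf, rfl⟩
      · rintro ⟨f, _, rfl, hf, rfl⟩
        exact ⟨f, hf.1, hf, rfl⟩)
  refine ⟨R, fun x => (hR x).1, fun f p => (hR _).trans ⟨?_, fun h => ⟨f, p, rfl, h⟩⟩⟩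
  rintro ⟨f', p', h, h'⟩
  obtain ⟨rfl, rfl⟩ := hM.pr_inj.1 h
  exact h'

theorem exists_graphs (hb : ∀ G ∈ 𝒢.1, M.lt G b) :
    ∃ D : M.sets, ∀ τ G, M.pr τ G ∈ D.1 ↔ M.GraphOf 𝒢.1 τ G := by
  obtain ⟨D, hD⟩ := hM.delta0_comprehension
    (P := fun x => ∃ τ G, x = M.pr τ G ∧ M.GraphOf 𝒢.1 τ G)
    (graphFml (.var 0) 3) isDelta0_graphFml (fun _ => b) (fun _ => 𝒢) 0 2 (fun x c => by
      -- The last alternative proves that `v₁` still bounds 𝒢: the updates touch only other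
      -- variables.
      simp (disch := (first
          | (try simp only [Term.bd, bd_succ]
             omega)
          | simpa (disch := omega) only [update_of_ne] using hb)) only
        [graphFml, sat_exLt, sat_and, sat_eq, hM.sat_linkFml,
          eval_var, eval_pr, eval_nodeTerm, eval_zero, eval_succ, update_self, update_of_ne]
      constructor
      · rintro ⟨f, -, G, -, g, -, h, rfl⟩
        exact ⟨_, _, rfl, f, g, h, rfl⟩
      · rintro ⟨_, G, rfl, f, g, h, rfl⟩
        have := hM.lt_of_link hb h
        exact ⟨f, this.1, G, this.2.1, g, this.2.2, h, rfl⟩)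
  refine ⟨D, fun f p => (hD _).trans ⟨?_, fun h => ⟨f, p, rfl, h⟩⟩⟩
  rintro ⟨f', p', h, h'⟩
  obtain ⟨rfl, rfl⟩ := hM.pr_inj.1 h
  exact h'

theorem exists_nodes (hb : ∀ G ∈ 𝒢.1, M.lt G b) :
    ∃ D : M.sets, (∀ x ∈ D.1, ∃ p q r, x = M.pr p (M.pr q r) ∧ M.NodeOf 𝒢.1 b p q r) ∧
      ∀ p q r, M.pr p (M.pr q r) ∈ D.1 ↔ M.NodeOf 𝒢.1 b p q r := by
  obtain ⟨D, hD⟩ := hM.delta0_comprehension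
    (P := fun x => ∃ p q r, x = M.pr p (M.pr q r) ∧ M.NodeOf 𝒢.1 b p q r)
    (nodeFml (.var 0) 3) isDelta0_nodeFml (fun _ => b) (fun _ => 𝒢) 0 2 (fun x c => by
      simp (disch := (first
          | (try simp only [Term.bd, bd_succ]
             omega)
          | simpa (disch := omega) only [update_of_ne] using hb)) only
        [nodeFml, sat_exLt, sat_and, sat_or, sat_neg, sat_eq, sat_lt, hM.sat_linkFml, hM.sat_funLtFml,
          sat_isFunFml, eval_var, eval_pr, eval_num, eval_nodeTerm, eval_zero, eval_succ,
          update_self, update_of_ne]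
      constructor
      · rintro ⟨f, -, ⟨hf, rfl⟩ | ⟨j, hj, hf, ⟨g, -, h, rfl⟩ | ⟨h, rfl⟩⟩ |
          ⟨G, -, g, -, m, -, i, -, h, ⟨a, -, ha⟩, hi, rfl⟩⟩
        · exact ⟨_, _, _, rfl, .inl ⟨hf, rfl, rfl⟩⟩
        · exact ⟨_, _, _, rfl, .inr (.inl ⟨j, hf, hj, rfl, .inl ⟨g, h, rfl⟩⟩)⟩
        · refine ⟨_, _, _, rfl, .inr (.inl ⟨j, hf, hj, rfl, .inr ⟨fun ⟨g, hg⟩ => h ?_, rfl⟩⟩)⟩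
          exact ⟨g, (hM.lt_of_link hb hg).2.2, hg⟩
        · exact ⟨_, _, _, rfl, .inr (.inr ⟨G, g, m, i, h, ⟨a, ha⟩, hi, rfl, rfl⟩)⟩
      · rintro ⟨_, f, _, rfl, ⟨hf, rfl, rfl⟩ | ⟨j, hf, hj, rfl, ⟨g, h, rfl⟩ | ⟨h, rfl⟩⟩ |
          ⟨G, g, m, i, h, ⟨a, rfl⟩, hi, rfl, rfl⟩⟩
        · exact ⟨f, hf.1, .inl ⟨hf, rfl⟩⟩
        · exact ⟨f, hf.1, .inr (.inl ⟨j, hj, hf, .inl ⟨g, (hM.lt_of_link hb h).2.2, h, rfl⟩⟩)⟩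
        · exact ⟨f, hf.1, .inr (.inl ⟨j, hj, hf, .inr ⟨fun ⟨g, _, hg⟩ => h ⟨g, hg⟩, rfl⟩⟩)⟩
        -- The missing bounds come from decoding: `g < b` as a component of `G`, its name and arity
        -- `m` as components of `g`, and finally `i < m`.
        · have h1 := hM.lt_of_link hb h
          have h2 := hM.lt_of_pr_lt h1.2.2
          exact ⟨f, h1.1, .inr (.inr ⟨G, h1.2.1, _, h1.2.2, m, h2.2, i, hM.lt_trans hi h2.2, h,
            ⟨a, h2.1, rfl⟩, hi, rfl⟩)⟩)
  refine ⟨D, fun x => (hD x).1, fun p q r => (hD _).trans ⟨?_, fun h => ⟨p, q, r, rfl, h⟩⟩⟩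
  rintro ⟨p', q', r', h, h'⟩
  obtain ⟨rfl, e⟩ := hM.pr_inj.1 h
  obtain ⟨rfl, rfl⟩ := hM.pr_inj.1 e
  exact h'

theorem exists_children (hb : ∀ G ∈ 𝒢.1, M.lt G b) :
    ∃ D : M.sets, (∀ x ∈ D.1, ∃ p q r, x = M.pr p (M.pr q r) ∧ M.ChildOf 𝒢.1 b p q r) ∧
      ∀ p q r, M.pr p (M.pr q r) ∈ D.1 ↔ M.ChildOf 𝒢.1 b p q r := by
  obtain ⟨D, hD⟩ := hM.delta0_comprehension
    (P := fun x => ∃ p q r, x = M.pr p (M.pr q r) ∧ M.ChildOf 𝒢.1 b p q r)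
    (childFml (.var 0) 3) isDelta0_childFml (fun _ => b) (fun _ => 𝒢) 0 2 (fun x c => by
      simp (disch := (first
          | (try simp only [Term.bd, bd_succ]
             omega)
          | simpa (disch := omega) only [update_of_ne] using hb)) only
        [childFml, sat_exLt, sat_and, sat_or, sat_eq, sat_lt, hM.sat_linkFml, hM.sat_funLtFml,
          sat_isFunFml, eval_var, eval_pr, eval_nodeTerm, eval_zero, eval_succ,
          update_self, update_of_ne]
      constructor
      · rintro ⟨f, -, j, hj, ⟨hf, rfl⟩ | ⟨G, -, g, -, m, -, h, ⟨a, -, ha⟩, hi, rfl⟩⟩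
        · exact ⟨_, _, _, rfl, .inl ⟨f, hf, hj, rfl, rfl⟩⟩
        · exact ⟨_, _, _, rfl, .inr ⟨f, G, g, m, h, ⟨a, ha⟩, hi, rfl, rfl⟩⟩
      · rintro ⟨_, j, _, rfl, ⟨f, hf, hj, rfl, rfl⟩ |
          ⟨f, G, g, m, h, ⟨a, rfl⟩, hi, rfl, rfl⟩⟩
        · exact ⟨f, hf.1, j, hj, .inl ⟨hf, rfl⟩⟩
        · have h1 := hM.lt_of_link hb h
          have h2 := hM.lt_of_pr_lt h1.2.2
          exact ⟨f, h1.1, j, hM.lt_trans hi h2.2, .inr ⟨G, h1.2.1, _, h1.2.2, m, h2.2, h,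
            ⟨a, h2.1, rfl⟩, hi, rfl⟩⟩)
  refine ⟨D, fun x => (hD x).1, fun p q r => (hD _).trans ⟨?_, fun h => ⟨p, q, r, rfl, h⟩⟩⟩
  rintro ⟨p', q', r', h, h'⟩
  obtain ⟨rfl, e⟩ := hM.pr_inj.1 h
  obtain ⟨rfl, rfl⟩ := hM.pr_inj.1 e
  exact h'

end IsModelRCA0
end Model
end SOA

/-! ### The associated program obeys the grammar and is described by 𝒢 -/

namespace SOA.Model

variable {M : Model}

theorem hasChildren_zero (hM : M.IsModelRCA0) {C : Set M.Num} {p : M.Num}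
    {Q : M.Num → M.Num → Prop} (h : ∀ j c, ¬ M.IsChild C p j c) : M.HasChildren C p M.zero Q :=
  ⟨fun j c hc => (h j c hc).elim, fun j hj => (hM.not_lt_zero j hj).elim⟩

namespace IsModelRCA0

variable (hM : M.IsModelRCA0) {𝒢 : M.sets} {b : M.Num}
include hM

theorem succ_inj_iff {m n : M.Num} : M.add m M.one = M.add n M.one ↔ m = n :=
  ⟨hM.succ_inj m n, fun h => h ▸ rfl⟩

theorem zero_ne_succ (n : M.Num) : M.zero ≠ M.add n M.one := (hM.succ_ne_zero n).symm

theorem zero_lt_succ (n : M.Num) : M.lt M.zero (M.add n M.one) := (hM.lt_succ _ _).2 (hM.zero_le n)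

theorem node_inj {f j i f' j' i' : M.Num} :
    M.node f j i = M.node f' j' i' ↔ f = f' ∧ j = j' ∧ i = i' := by
  simp only [node, hM.pr_inj]

/-- Roots, slots and arguments differ in which of their last two components are zero. In a slot, the
code `j` determines the target of the call, and the call and the filler exclude each other. -/
theorem nodeOf_unique {p f l f' l' : M.Num} (h : M.NodeOf 𝒢.1 b p f l)
    (h' : M.NodeOf 𝒢.1 b p f' l') : f' = f ∧ l' = l := by
  rcases h with ⟨-, rfl, rfl⟩ | ⟨j, -, -, rfl, h⟩ | ⟨G, g, m, i, -, -, -, rfl, rfl⟩ <;>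
  rcases h' with ⟨-, e, rfl⟩ | ⟨j', -, -, e, h'⟩ | ⟨G', g', m', i', -, -, -, e, rfl⟩ <;>
  -- Mixed cases would equate zero with a successor, so only the three diagonal ones survive.
  simp only [hM.node_inj, hM.succ_ne_zero, hM.zero_ne_succ, hM.succ_inj_iff, and_false,
    and_true] at e
  · exact ⟨e.symm, rfl⟩
  · obtain ⟨rfl, rfl⟩ := e
    rcases h with ⟨g, hg, rfl⟩ | ⟨h, rfl⟩ <;> rcases h' with ⟨g', hg', rfl⟩ | ⟨h', rfl⟩
    · rw [(hM.link_inj hg hg').2]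
      exact ⟨rfl, rfl⟩
    · exact (h' ⟨g, hg⟩).elim
    · exact (h ⟨g', hg'⟩).elim
    · exact ⟨rfl, rfl⟩
  · exact ⟨e.1.symm, rfl⟩

theorem childOf_root_iff {f j c : M.Num} : M.ChildOf 𝒢.1 b (M.node f M.zero M.zero) j c ↔
    M.FunLt b f ∧ M.lt j b ∧ c = M.node f (M.add j M.one) M.zero := by
  constructor
  · rintro (⟨f', hf, hj, e, rfl⟩ | ⟨f', G, g, m, -, -, -, e, rfl⟩)
    · obtain rfl := (hM.node_inj.1 e).1
      exact ⟨hf, hj, rfl⟩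
    · exact (hM.zero_ne_succ _ (hM.node_inj.1 e).2.1).elim
  · rintro ⟨hf, hj, rfl⟩
    exact .inl ⟨f, hf, hj, rfl, rfl⟩

/-- This also covers the slots without a call: no graph means no children, as a nullary operator
requires. -/
theorem childOf_call_iff {f k j c : M.Num} :
    M.ChildOf 𝒢.1 b (M.node f (M.add k M.one) M.zero) j c ↔
      ∃ g m, M.Link 𝒢.1 f k g ∧ M.IsFun g m ∧ M.lt j m ∧
        c = M.node f (M.add k M.one) (M.add j M.one) := by
  constructor
  · rintro (⟨f', -, -, e, rfl⟩ | ⟨f', G, g, m, h, hm, hj, e, rfl⟩)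
    · exact (hM.succ_ne_zero _ (hM.node_inj.1 e).2.1).elim
    · obtain ⟨rfl, e, -⟩ := hM.node_inj.1 e
      obtain rfl := hM.succ_inj_iff.1 e
      exact ⟨g, m, h, hm, hj, rfl⟩
  · rintro ⟨g, m, h, hm, hj, rfl⟩
    exact .inr ⟨f, k, g, m, h, hm, hj, rfl, rfl⟩

theorem not_childOf_arg {f k i j c : M.Num} :
    ¬ M.ChildOf 𝒢.1 b (M.node f k (M.add i M.one)) j c := by
  rintro (⟨f', -, -, e, rfl⟩ | ⟨f', G, g, m, -, -, -, e, rfl⟩)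
  · exact hM.succ_ne_zero _ (hM.node_inj.1 e).2.2
  · exact hM.succ_ne_zero _ (hM.node_inj.1 e).2.2

theorem not_childOf_of_root {q j f : M.Num} :
    ¬ M.ChildOf 𝒢.1 b q j (M.node f M.zero M.zero) := by
  rintro (⟨f', -, -, rfl, e⟩ | ⟨f', G, g, m, -, -, -, rfl, e⟩)
  · exact hM.zero_ne_succ _ (hM.node_inj.1 e).2.1
  · exact hM.zero_ne_succ _ (hM.node_inj.1 e).2.1

/-- Replacing the last nonzero component of a child by zero gives its parent, and the predecessor of
that component is its number. -/
theorem childOf_parent_unique {p j q i c : M.Num} (h : M.ChildOf 𝒢.1 b p j c)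
    (h' : M.ChildOf 𝒢.1 b q i c) : q = p ∧ i = j := by
  rcases h with ⟨f, -, -, rfl, rfl⟩ | ⟨f, G, g, m, -, -, -, rfl, rfl⟩ <;>
  rcases h' with ⟨f', -, -, rfl, e⟩ | ⟨f', G', g', m', -, -, -, rfl, e⟩ <;>
  simp only [hM.node_inj, hM.succ_ne_zero, hM.zero_ne_succ, hM.succ_inj_iff, and_false,
    and_true] at e
  · obtain ⟨rfl, rfl⟩ := e
    exact ⟨rfl, rfl⟩
  · obtain ⟨rfl, rfl, rfl⟩ := e
    exact ⟨rfl, rfl⟩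

/-- A parent has zero where its child has a successor, and pairing is strictly monotone. -/
theorem lt_of_childOf {p j c : M.Num} (h : M.ChildOf 𝒢.1 b p j c) : M.lt p c := by
  rcases h with ⟨f, -, -, rfl, rfl⟩ | ⟨f, G, g, m, -, -, -, rfl, rfl⟩
  · exact hM.pr_lt_pr_right _ (hM.pr_lt_pr_left (hM.zero_lt_succ _) _)
  · exact hM.pr_lt_pr_right _ (hM.pr_lt_pr_right _ (hM.zero_lt_succ _))

omit hM in
/-- Every `j < b` is the number of a child of the root of each body. -/
theorem exists_nodeOf_child {f j : M.Num} (hf : M.FunLt b f) (hj : M.lt j b) :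
    ∃ l, M.NodeOf 𝒢.1 b (M.node f (M.add j M.one) M.zero) f l := by
  by_cases h : ∃ g, M.Link 𝒢.1 f j g
  · obtain ⟨g, hg⟩ := h
    exact ⟨_, .inr (.inl ⟨j, hf, hj, rfl, .inl ⟨g, hg, rfl⟩⟩)⟩
  · exact ⟨_, .inr (.inl ⟨j, hf, hj, rfl, .inr ⟨h, rfl⟩⟩)⟩

omit hM in
-- Only operators and calls occur as labels, so every condition on the kind of a child is met as
-- soon as the child is a node.
theorem isArith_of_nodeOf {L : Set M.Num} (hL : ∀ p f l, M.IsNode L p f l ↔ M.NodeOf 𝒢.1 b p f l)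
    {p f l : M.Num} (h : M.NodeOf 𝒢.1 b p f l) : M.IsArith L p := by
  have h3 : ∀ a, l = M.pr (M.num 3) a → M.IsArith L p := fun a e =>
    .inr (.inr (.inr (.inl ⟨f, a, (hL _ _ _).2 (e ▸ h)⟩)))
  rcases id h with ⟨-, -, e⟩ | ⟨j, -, -, -, ⟨g, -, e⟩ | ⟨-, e⟩⟩ | ⟨G, g, m, i, -, -, -, -, e⟩
  · exact h3 _ e
  · exact .inr (.inr (.inr (.inr ⟨f, g, (hL _ _ _).2 (e ▸ h)⟩)))
  · exact h3 _ e
  · exact h3 _ e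

/-- Both ends of an edge of the associated program are nodes of the same body. -/
theorem exists_nodeOf_of_childOf (h𝒢 : ∀ G ∈ 𝒢.1, ∃ f g, M.IsGraph G f g)
    (hb : ∀ G ∈ 𝒢.1, M.lt G b) {p j c : M.Num} (h : M.ChildOf 𝒢.1 b p j c) :
    ∃ f l l', M.NodeOf 𝒢.1 b p f l ∧ M.NodeOf 𝒢.1 b c f l' := by
  rcases h with ⟨f, hf, hj, rfl, rfl⟩ | ⟨f, G, g, m, h, hm, hj, rfl, rfl⟩
  · obtain ⟨l, hl⟩ := exists_nodeOf_child hf hj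
    exact ⟨f, _, l, .inl ⟨hf, rfl, rfl⟩, hl⟩
  · obtain ⟨l, hl⟩ := exists_nodeOf_child (hM.funLt_of_link h𝒢 hb h).1 (hb _ h.1)
    exact ⟨f, l, _, hl, .inr (.inr ⟨G, g, m, j, h, hm, hj, rfl, rfl⟩)⟩

/-- A root is a `b`-ary operator, a call has as many arguments as the arity of its target, and the
fillers and arguments are nullary operators. -/
theorem obeysGrammar_of_nodeOf {L C R : Set M.Num} (h𝒢 : ∀ G ∈ 𝒢.1, ∃ f g, M.IsGraph G f g)
    (hb : ∀ G ∈ 𝒢.1, M.lt G b) (hL : ∀ p f l, M.IsNode L p f l ↔ M.NodeOf 𝒢.1 b p f l)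
    (hC : ∀ p j c, M.IsChild C p j c ↔ M.ChildOf 𝒢.1 b p j c)
    (hR : ∀ f p, M.pr f p ∈ R ↔ M.RootOf b f p) {p f l : M.Num} (h : M.NodeOf 𝒢.1 b p f l) :
    M.ObeysGrammar L C R p f l := by
  have arith : ∀ p j c, M.IsChild C p j c → M.IsArith L c := fun p j c hc => by
    obtain ⟨f, l, l', -, h'⟩ := hM.exists_nodeOf_of_childOf h𝒢 hb ((hC _ _ _).1 hc)
    exact isArith_of_nodeOf hL h'
  rcases h with ⟨⟨hf, n, hn⟩, rfl, rfl⟩ | ⟨j, ⟨hf, n, hn⟩, hj, rfl, ⟨g, hg, rfl⟩ | ⟨h, rfl⟩⟩ |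
    ⟨G, g, m, i, h, hm, hi, rfl, rfl⟩
  · refine ⟨n, hn, .inr (.inl ⟨_, _, rfl, fun j c hc => ⟨?_, arith _ _ _ hc⟩, fun j hj => ?_⟩)⟩
    · exact (hM.childOf_root_iff.1 ((hC _ _ _).1 hc)).2.1
    · exact ⟨_, (hC _ _ _).2 (hM.childOf_root_iff.2 ⟨⟨hf, n, hn⟩, hj, rfl⟩), fun c' hc' =>
        (hM.childOf_root_iff.1 ((hC _ _ _).1 hc')).2.2⟩
  -- The called function also lies below `b`, hence has a body in the program.
  · obtain ⟨hg', m, hm⟩ := (hM.funLt_of_link h𝒢 hb hg).2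
    refine ⟨n, hn, .inr (.inr (.inl ⟨g, m, rfl, ⟨_, (hR _ _).2 ⟨⟨hg', m, hm⟩, rfl⟩⟩, hm,
      fun i c hc => ⟨?_, arith _ _ _ hc⟩, fun i hi => ?_⟩))⟩
    · obtain ⟨g', m', h, hm', hi, -⟩ := hM.childOf_call_iff.1 ((hC _ _ _).1 hc)
      obtain ⟨-, rfl⟩ := hM.link_inj hg h
      rwa [hM.isFun_inj hm hm']
    · refine ⟨_, (hC _ _ _).2 (hM.childOf_call_iff.2 ⟨g, m, hg, hm, hi, rfl⟩), fun c' hc' => ?_⟩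
      obtain ⟨-, -, -, -, -, e⟩ := hM.childOf_call_iff.1 ((hC _ _ _).1 hc')
      exact e
  · refine ⟨n, hn, .inr (.inl ⟨_, _, rfl, hasChildren_zero hM fun i c hc => ?_⟩)⟩
    obtain ⟨g, -, hg, -⟩ := hM.childOf_call_iff.1 ((hC _ _ _).1 hc)
    exact h ⟨g, hg⟩
  · obtain ⟨n, hn⟩ := (hM.exists_isFun_of_link h𝒢 h).1
    exact ⟨n, hn, .inr (.inl ⟨_, _, rfl, hasChildren_zero hM fun i c hc =>
      hM.not_childOf_arg ((hC _ _ _).1 hc)⟩)⟩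

omit hM in
theorem root_or_child_of_nodeOf {p f l : M.Num} (h : M.NodeOf 𝒢.1 b p f l) :
    M.RootOf b f p ∨ ∃ q j, M.ChildOf 𝒢.1 b q j p := by
  rcases h with ⟨hf, rfl, -⟩ | ⟨j, hf, hj, rfl, -⟩ | ⟨G, g, m, i, h, hm, hi, rfl, -⟩
  · exact .inl ⟨hf, rfl⟩
  · exact .inr ⟨_, j, .inl ⟨f, hf, hj, rfl, rfl⟩⟩
  · exact .inr ⟨_, i, .inr ⟨f, G, g, m, h, hm, hi, rfl, rfl⟩⟩

/-- All components of the associated program lie below a common bound. -/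
theorem exists_bound (hb : ∀ G ∈ 𝒢.1, M.lt G b)
    (hb₀ : M.lt M.zero b) :
    ∃ B, (∀ f, M.FunLt b f → M.lt f B) ∧
      (∀ p f l, M.NodeOf 𝒢.1 b p f l → M.lt p B ∧ M.lt f B ∧ M.lt l B) ∧
      ∀ p j c, M.ChildOf 𝒢.1 b p j c → M.lt j B := by
  -- Above `b + 1` because positions are shifted by one, and above 4, the largest tag in use.
  obtain ⟨c, hc, h4⟩ := hM.exists_lt (M.add b M.one) (M.num 4)
  have h3 : M.lt (M.num 3) c := hM.lt_trans (hM.lt_succ_self (M.num 3)) h4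
  have hbc : M.lt b c := hM.lt_trans (hM.lt_succ_self b) hc
  have h0 : M.lt M.zero c := hM.lt_trans hb₀ hbc
  have hlt : ∀ x, M.lt x b → M.lt x c := fun x hx => hM.lt_trans hx hbc
  have hs : ∀ x, M.lt x b → M.lt (M.add x M.one) c := fun x hx =>
    hM.lt_trans (hM.succ_lt_succ hx) hc
  have hcc : ∀ x, M.lt x c → M.lt x (M.pr c c) := fun x hx =>
    (hM.lt_of_pr_lt (hM.pr_lt_pr hx hx)).1
  have hB : ∀ x, M.lt x c → M.lt x (M.pr c (M.pr c c)) := fun x hx =>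
    (hM.lt_of_pr_lt (hM.pr_lt_pr hx (hcc x hx))).1
  have hn : ∀ x y z, M.lt x c → M.lt y c → M.lt z c →
      M.lt (M.pr x (M.pr y z)) (M.pr c (M.pr c c)) := fun x y z hx hy hz =>
    hM.pr_lt_pr hx (hM.pr_lt_pr hy hz)
  refine ⟨M.pr c (M.pr c c), fun f hf => hB _ (hlt _ hf.1), ?_, ?_⟩
  · rintro p f l (⟨hf, rfl, rfl⟩ | ⟨j, hf, hj, rfl, h⟩ | ⟨G, g, m, i, h, hm, hi, rfl, rfl⟩)
    · exact ⟨hn _ _ _ (hlt _ hf.1) h0 h0, hB _ (hlt _ hf.1), hn _ _ _ h3 h0 hbc⟩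
    · refine ⟨hn _ _ _ (hlt _ hf.1) (hs _ hj) h0, hB _ (hlt _ hf.1), ?_⟩
      rcases h with ⟨g, hg, rfl⟩ | ⟨-, rfl⟩
      · exact hM.pr_lt_pr h4 (hcc _ (hlt _ (hM.lt_of_link hb hg).2.2))
      · exact hn _ _ _ h3 h0 h0
    · have h1 := hM.lt_of_link hb h
      have hi' := hM.lt_trans hi (hM.lt_of_isFun hm h1.2.2)
      exact ⟨hn _ _ _ (hlt _ h1.1) (hs _ h1.2.1) (hs _ hi'), hB _ (hlt _ h1.1),
        hn _ _ _ h3 h0 h0⟩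
  · rintro p j c' (⟨f, hf, hj, -, -⟩ | ⟨f, G, g, m, h, hm, hj, -, -⟩)
    · exact hB _ (hlt _ hj)
    · exact hB _ (hlt _ (hM.lt_trans hj (hM.lt_of_isFun hm (hM.lt_of_link hb h).2.2)))

/-- Every finite set of size-change graphs is a description of some program. -/
theorem exists_program (h : M.IsGraphSet 𝒢.1) : ∃ (L C R : M.sets) (f₀ : M.Num),
    M.IsProgram L.1 C.1 R.1 f₀ ∧ M.IsDescription 𝒢.1 L.1 := by
  obtain ⟨⟨a, ha⟩, h𝒢⟩ := id h
  -- The bound has to be positive even if 𝒢 is empty, so that the initial function `0` lies below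
  -- it.
  obtain ⟨b, hb, hb₀⟩ : ∃ b, (∀ G ∈ 𝒢.1, M.lt G b) ∧ M.lt M.zero b :=
    ⟨M.add a M.one, fun G hG => hM.lt_trans (ha G hG) (hM.lt_succ_self a), hM.zero_lt_succ a⟩
  obtain ⟨L, hL', hL⟩ := hM.exists_nodes hb
  obtain ⟨C, hC', hC⟩ := hM.exists_children hb
  obtain ⟨R, hR', hR⟩ := hM.exists_roots (b := b)
  obtain ⟨D, hD⟩ := hM.exists_graphs hb
  obtain ⟨B, hBf, hBn, hBc⟩ := hM.exists_bound hb hb₀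
  have hroot : ∀ {f}, M.FunLt b f → M.NodeOf 𝒢.1 b (M.node f M.zero M.zero) f
      (M.pr (M.num 3) (M.pr M.zero b)) := fun hf => .inl ⟨hf, rfl, rfl⟩
  refine ⟨L, C, R, M.zero, ⟨⟨M.pr B (M.pr B B), ?_⟩, ⟨M.pr B (M.pr B B), ?_⟩, ⟨M.pr B B, ?_⟩,
    fun p f l hp => ⟨fun f' l' hp' => hM.nodeOf_unique ((hL _ _ _).1 hp) ((hL _ _ _).1 hp'),
      hM.obeysGrammar_of_nodeOf h𝒢 hb hL hC hR ((hL _ _ _).1 hp)⟩,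
    fun p f l hp => ?_, fun p j c hc => ⟨?_, ?_, ?_⟩, fun f p hp => ?_, ?_⟩, h, D, ?_, ?_⟩
  · intro x hx
    obtain ⟨p, f, l, rfl, hp⟩ := hL' x hx
    obtain ⟨h1, h2, h3⟩ := hBn _ _ _ hp
    exact hM.pr_lt_pr h1 (hM.pr_lt_pr h2 h3)
  · intro x hx
    obtain ⟨p, j, c, rfl, hc⟩ := hC' x hx
    obtain ⟨f, l, l', h1, h2⟩ := hM.exists_nodeOf_of_childOf h𝒢 hb hc
    exact hM.pr_lt_pr (hBn _ _ _ h1).1 (hM.pr_lt_pr (hBc _ _ _ hc) (hBn _ _ _ h2).1)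
  · intro x hx
    obtain ⟨f, p, rfl, hf, rfl⟩ := hR' x hx
    exact hM.pr_lt_pr (hBf _ hf) (hBn _ _ _ (hroot hf)).1
  · rcases root_or_child_of_nodeOf ((hL _ _ _).1 hp) with h | ⟨q, j, h⟩
    · exact .inl ((hR _ _).2 h)
    · exact .inr ⟨q, j, (hC _ _ _).2 h⟩
  · exact hM.lt_of_childOf ((hC _ _ _).1 hc)
  · obtain ⟨f, l, l', h1, h2⟩ := hM.exists_nodeOf_of_childOf h𝒢 hb ((hC _ _ _).1 hc)
    exact ⟨f, l, l', (hL _ _ _).2 h1, (hL _ _ _).2 h2⟩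
  · exact fun q i hc' => hM.childOf_parent_unique ((hC _ _ _).1 hc) ((hC _ _ _).1 hc')
  · obtain ⟨hf, rfl⟩ := (hR _ _).1 hp
    exact ⟨hf.2, fun p' hp' => ((hR _ _).1 hp').2, ⟨_, (hL _ _ _).2 (hroot hf)⟩,
      .inl (isArith_of_nodeOf hL (hroot hf)),
      fun q j hc => hM.not_childOf_of_root ((hC _ _ _).1 hc)⟩
  -- The number `0` equals the pair `(0, 0)`, hence is a function identifier of arity zero.
  · refine ⟨_, (hR _ _).2 ⟨⟨hb₀, M.zero, M.zero, ?_⟩, rfl⟩⟩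
    simp only [pr, hM.add_zero, hM.mul_zero]
  · intro τ f g hτ
    -- Tag 4 occurs only in slots that belong to a graph; the other nodes carry tag 3.
    obtain ⟨G, hG, rfl⟩ : ∃ G, M.Link 𝒢.1 f G g ∧ τ = M.node f (M.add G M.one) M.zero := by
      rcases (hL _ _ _).1 hτ with ⟨-, -, e⟩ | ⟨j, -, -, rfl, ⟨g', hg, e⟩ | ⟨-, e⟩⟩ |
        ⟨-, -, -, -, -, -, -, -, e⟩
      · exact absurd (hM.num_inj.1 (hM.pr_inj.1 e).1) (by decide)
      · obtain rfl := (hM.pr_inj.1 e).2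
        exact ⟨j, hg, rfl⟩
      · exact absurd (hM.num_inj.1 (hM.pr_inj.1 e).1) (by decide)
      · exact absurd (hM.num_inj.1 (hM.pr_inj.1 e).1) (by decide)
    -- The position of a call is the successor of its graph, which makes the assigned graph unique.
    have key : ∀ G', M.pr (M.node f (M.add G M.one) M.zero) G' ∈ D.1 → G' = G := by
      intro G' hG'
      obtain ⟨f', g', -, e⟩ := (hD _ _).1 hG'
      exact (hM.succ_inj_iff.1 (hM.node_inj.1 e).2.1).symm
    refine ⟨⟨G, (hD _ _).2 ⟨f, g, hG, rfl⟩, key⟩, fun G' hG' => ?_⟩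
    rw [key G' hG']
    exact ⟨hG.1, hM.isGraph_of_link h𝒢 hG⟩
  -- Every member of 𝒢 is assigned to the call in its own slot, in the body of its source.
  · intro G hG
    obtain ⟨f, g, hfg⟩ := exists_link h𝒢 hG
    exact ⟨_, f, g, (hL _ _ _).2 (.inr (.inl ⟨G, (hM.funLt_of_link h𝒢 hb hfg).1, hb G hG, rfl,
      .inl ⟨g, hfg, rfl⟩⟩)), (hD _ _).2 ⟨f, g, hfg, rfl⟩⟩

end IsModelRCA0

end SOA.Model

/-- `RCA₀` proves that the SCT criterion is equivalent to the SCT criterion for graphs. -/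
theorem mainTheorem7 :
    SOA.RCA0Proves (SOA.sentence (SOA.iff SCT.sctCriterion SCT.sctCriterionForGraphs)) := by
  intro M hM v V
  refine (SOA.Model.sat_iff _ _).2 ?_
  rw [SOA.Model.sat_sctCriterion, SOA.Model.sat_sctCriterionForGraphs]
  constructor
  · intro h 𝒢 h𝒢
    obtain ⟨L, C, R, f₀, hP⟩ := hM.exists_program h𝒢
    exact h L C R f₀ 𝒢 hP
  · exact fun h L C R f₀ 𝒢 hP => h 𝒢 hP.2.1
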